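/- Let $(M,g)$ be an $n$-dimensional smooth (Hausdorff) Riemannian manifold without boundary, with Levi-Civita connection $\nabla$, Christoffel symbols $\Gamma^h_{ij}$ and curvature tensor $R$, and let $f\in C^\infty(M)$ with $f>0$. Let $T^*M$ be the cotangent bundle, with the coordinates $(x^i,p_i)$ induced by local coordinates $x^i$ of $M$. For a covector field $\omega$ and a vector field $X$ on $M$ let $${}^V\omega=\omega_i\,\frac{\partial}{\partial p_i},\qquad {}^HX=X^i\frac{\partial}{\partial x^i}+p_h\Gamma^h_{ij}X^j\frac{\partial}{\partial p_i}$$ be the vertical and the horizontal lift. Put $\alpha=1+g^{-1}(p,p)$, where $g^{-1}(\omega,\theta)=g^{ij}\omega_i\theta_j$, and let ${}^{CG}g_f$ be the rescaled Riemannian metric of Cheeger–Gromoll type on $T^*M$, defined by $${}^{CG}g_f({}^V\omega,{}^V\theta)=\tfrac1\alpha\bigl(g^{-1}(\omega,\theta)+g^{-1}(\omega,p)\,g^{-1}(\theta,p)\bigr),\quad {}^{CG}g_f({}^V\omega,{}^HY)=0,\quad {}^{CG}g_f({}^HX,{}^HY)=f\,g(X,Y).$$ Let $J$ be the almost product structure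 on $T^*M$ with $J({}^HX)=-{}^HX$ and $J({}^V\omega)={}^V\omega$. Let $\widetilde\nabla$ be the Levi-Civita connection of ${}^{CG}g_f$, and for vector fields $\widetilde X,\widetilde Y$ on $T^*M$ put $$\widetilde S(\widetilde X,\widetilde Y)=\tfrac12\bigl\{(\widetilde\nabla_{J\widetilde Y}J)\widetilde X+J\bigl((\widetilde\nabla_{\widetilde Y}J)\widetilde X\bigr)-J\bigl((\widetilde\nabla_{\widetilde X}J)\widetilde Y\bigr)\bigr\},\qquad \overline\nabla_{\widetilde X}\widetilde Y=\widetilde\nabla_{\widetilde X}\widetilde Y-\widetilde S(\widetilde X,\widetilde Y).$$ Then the almost product connection $\overline\nabla$ is symmetric, that is, $\overline\nabla_{\widetilde X}\widetilde Y-\overline\nabla_{\widetilde Y}\widetilde X=[\widetilde X,\widetilde Y]$ for all smooth vector fields $\widetilde X,\widetilde Y$ on $T^*M$, if and only if $M$ is flat, that is, $R=0$. -/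

import Mathlib

set_option maxSynthPendingDepth 3

open Bundle Manifold VectorField Set
open scoped ContDiff Topology

noncomputable section

namespace CheegerGromoll

/-- The bilinear form `(v, w) ↦ B (D v) (D w)`. -/
def pullbackForm {V W : Type*} [AddCommGroup V] [Module ℝ V] [TopologicalSpace V]
    [IsTopologicalAddGroup V] [ContinuousSMul ℝ V]
    [AddCommGroup W] [Module ℝ W] [TopologicalSpace W]
    [IsTopologicalAddGroup W] [ContinuousSMul ℝ W]
    (B : V →L[ℝ] V →L[ℝ] ℝ) (D : W →L[ℝ] V) : W →L[ℝ] W →L[ℝ] ℝ :=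
  D.precomp ℝ ∘L B ∘L D

@[simp] lemma pullbackForm_apply {V W : Type*} [AddCommGroup V] [Module ℝ V] [TopologicalSpace V]
    [IsTopologicalAddGroup V] [ContinuousSMul ℝ V]
    [AddCommGroup W] [Module ℝ W] [TopologicalSpace W]
    [IsTopologicalAddGroup W] [ContinuousSMul ℝ W]
    (B : V →L[ℝ] V →L[ℝ] ℝ) (D : W →L[ℝ] V) (v w : W) :
    pullbackForm B D v w = B (D v) (D w) := rfl

/-- The dual form `B⁻¹` of a nondegenerate bilinear form `B` on a finite-dimensional space `V`, on
the dual of `V`: if `B` has components `B_{ij}`, then `B⁻¹(ω, θ) = B^{ij} ω_i θ_j`. Here `B` is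
seen as the map `V → V*` lowering indices, and its inverse raises them. -/
def dualForm {V : Type*} [AddCommGroup V] [Module ℝ V] [TopologicalSpace V]
    [IsTopologicalAddGroup V] [ContinuousSMul ℝ V]
    (B : V →L[ℝ] V →L[ℝ] ℝ) : (V →L[ℝ] ℝ) →L[ℝ] (V →L[ℝ] ℝ) →L[ℝ] ℝ :=
  pullbackForm B B.inverse

/-- The tensor product `ℓ ⊗ ℓ`, i.e. the bilinear form `(v, w) ↦ ℓ v * ℓ w`. -/
def tensorSquare {V : Type*} [AddCommGroup V] [Module ℝ V] [TopologicalSpace V]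
    [IsTopologicalAddGroup V] [ContinuousSMul ℝ V] (l : V →L[ℝ] ℝ) : V →L[ℝ] V →L[ℝ] ℝ :=
  l.smulRight l

/-! ### The Levi-Civita connection of a metric -/

section LeviCivita

variable {E : Type*} [NormedAddCommGroup E] [NormedSpace ℝ E]
  {H : Type*} [TopologicalSpace H] (I : ModelWithCorners ℝ E H)
  {M : Type*} [TopologicalSpace M] [ChartedSpace H M]

/-- The differential at `x` of the preferred chart at `x`: it sends a tangent vector at `x` to its
components in this chart. -/
def toCoord (x : M) : TangentSpace I x →L[ℝ] E :=
  mfderiv I 𝓘(ℝ, E) (extChartAt I x) x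

/-- The tangent vector `u^i ∂_i` at the point with coordinates `y` in the preferred chart at `x`. -/
def ofCoord (x : M) (y : E) : E →L[ℝ] TangentSpace I ((extChartAt I x).symm y) :=
  mfderiv 𝓘(ℝ, E) I (extChartAt I x).symm y

/-- The tangent vector at `x` with given components in the preferred chart at `x`. -/
def ofCoordAt (x : M) : E →L[ℝ] TangentSpace I x :=
  (toCoord I x).inverse

/-- In the preferred chart at `x`, Mathlib's tangent space at `x` is the model space itself. -/
lemma toCoord_eq [IsManifold I 1 M] (x : M) :
    toCoord I x = (ContinuousLinearMap.id ℝ E : E →L[ℝ] E) := by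
  unfold toCoord
  ext v
  have := TangentBundle.continuousLinearMapAt_trivializationAt (I := I) (x₀ := x) (x := x)
    (mem_chart_source H x)
  rw [← this, TangentBundle.continuousLinearMapAt_trivializationAt_eq_core (mem_chart_source H x)]
  exact (tangentBundleCore I M).coordChange_self (achart H x) x (mem_chart_source H x) v

lemma ofCoordAt_toCoord [IsManifold I 1 M] (x : M) (v : TangentSpace I x) :
    ofCoordAt I x (toCoord I x v) = v := by
  unfold ofCoordAt
  rw [toCoord_eq]
  exact DFunLike.congr_fun (ContinuousLinearMap.inverse_id (R := ℝ) (M := E)) v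

lemma toCoord_ofCoordAt [IsManifold I 1 M] (x : M) (v : E) :
    toCoord I x (ofCoordAt I x v) = v := by
  unfold ofCoordAt
  rw [toCoord_eq]
  exact DFunLike.congr_fun (ContinuousLinearMap.inverse_id (R := ℝ) (M := E)) v

/-- The components `h_{ij}` of the metric `h` in the chart at `x`, as a function of the
coordinates. -/
def metricInChart (h : Π x : M, TangentSpace I x →L[ℝ] TangentSpace I x →L[ℝ] ℝ) (x : M)
    (y : E) : E →L[ℝ] E →L[ℝ] ℝ :=
  pullbackForm (h ((extChartAt I x).symm y)) (ofCoord I x y)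

/-- The components `Y^i` of the vector field `Y` in the chart at `x`, as a function of the
coordinates. -/
def fieldInChart (Y : Π x : M, TangentSpace I x) (x : M) (y : E) : E :=
  (ofCoord I x y).inverse (Y ((extChartAt I x).symm y))

/-- The derivatives `∂_k h_{ij}` at `x` of the components of `h` in the chart at `x`, as the
trilinear form `(u, v, w) ↦ u^k v^i w^j ∂_k h_{ij}`. -/
def metricDeriv (h : Π x : M, TangentSpace I x →L[ℝ] TangentSpace I x →L[ℝ] ℝ) (x : M) :
    E →L[ℝ] E →L[ℝ] E →L[ℝ] ℝ :=
  fderiv ℝ (metricInChart I h x) (extChartAt I x x)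

/-- The Christoffel symbols of the first kind
`Γ_{k,ij} = (∂_i h_{jk} + ∂_j h_{ik} - ∂_k h_{ij}) / 2` at `x` in the chart at `x`, as the
trilinear form `(u, v, w) ↦ u^i v^j w^k Γ_{k,ij}`. -/
def christoffelFirst (h : Π x : M, TangentSpace I x →L[ℝ] TangentSpace I x →L[ℝ] ℝ) (x : M) :
    E →L[ℝ] E →L[ℝ] E →L[ℝ] ℝ :=
  (1 / 2 : ℝ) • (metricDeriv I h x + (metricDeriv I h x).flip
    - (ContinuousLinearMap.flipₗᵢ ℝ E E ℝ).toContinuousLinearEquiv.toContinuousLinearMap ∘L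
        (metricDeriv I h x).flip)

lemma christoffelFirst_apply
    (h : Π x : M, TangentSpace I x →L[ℝ] TangentSpace I x →L[ℝ] ℝ) (x : M) (u v w : E) :
    christoffelFirst I h x u v w =
      (1 / 2) * (metricDeriv I h x u v w + metricDeriv I h x v u w - metricDeriv I h x w u v) :=
  rfl

/-- The Christoffel symbols `Γ^k_{ij} = h^{kl} Γ_{l,ij}` of `h` at `x` in the chart at `x`, as the
bilinear map `(u, v) ↦ (u^i v^j Γ^k_{ij})_k`. -/
def christoffel (h : Π x : M, TangentSpace I x →L[ℝ] TangentSpace I x →L[ℝ] ℝ) (x : M) :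
    E →L[ℝ] E →L[ℝ] E :=
  ((metricInChart I h x (extChartAt I x x)).inverse).postcomp E ∘L christoffelFirst I h x

/-- The Levi-Civita connection of the metric `h`, on a manifold without boundary: the vector field
`∇_X Y` with components `X^i ∂_i Y^k + Γ^k_{ij} X^i Y^j`, computed at each point `x` in the
preferred chart at `x`. -/
def leviCivita (h : Π x : M, TangentSpace I x →L[ℝ] TangentSpace I x →L[ℝ] ℝ)
    (X Y : Π x : M, TangentSpace I x) (x : M) : TangentSpace I x :=
  ofCoordAt I x
    (fderiv ℝ (fieldInChart I Y x) (extChartAt I x x) (toCoord I x (X x))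
      + christoffel I h x (toCoord I x (X x)) (toCoord I x (Y x)))

/-- The curvature `R(X, Y) Z = ∇_X ∇_Y Z - ∇_Y ∇_X Z - ∇_{[X, Y]} Z` of the Levi-Civita connection
of `h`. -/
def curvature (h : Π x : M, TangentSpace I x →L[ℝ] TangentSpace I x →L[ℝ] ℝ)
    (X Y Z : Π x : M, TangentSpace I x) : Π x : M, TangentSpace I x :=
  leviCivita I h X (leviCivita I h Y Z) - leviCivita I h Y (leviCivita I h X Z)
    - leviCivita I h (mlieBracket I X Y) Z

end LeviCivita

section SmoothFields

variable {E : Type*} [NormedAddCommGroup E] [NormedSpace ℝ E]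
  {H : Type*} [TopologicalSpace H] (I : ModelWithCorners ℝ E H)
  {M : Type*} [TopologicalSpace M] [ChartedSpace H M] [IsManifold I 1 M]

/-- `X` is a smooth vector field. -/
def IsSmoothField (X : Π x : M, TangentSpace I x) : Prop :=
  ContMDiff I I.tangent ∞ (fun x ↦ (⟨x, X x⟩ : TangentBundle I M))

/-- The metric `h` is flat: the curvature tensor of its Levi-Civita connection vanishes. -/
def IsFlat (h : Π x : M, TangentSpace I x →L[ℝ] TangentSpace I x →L[ℝ] ℝ) : Prop :=
  ∀ X Y Z : Π x : M, TangentSpace I x, IsSmoothField I X → IsSmoothField I Y → IsSmoothField I Z →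
    curvature I h X Y Z = 0

/-- The linear connection `(X, Y) ↦ ∇_X Y` is symmetric: its torsion
`∇_X Y - ∇_Y X - [X, Y]` vanishes for all smooth vector fields. -/
def IsSymmetricConnection
    (D : (Π x : M, TangentSpace I x) → (Π x : M, TangentSpace I x) → Π x : M, TangentSpace I x) :
    Prop :=
  ∀ X Y : Π x : M, TangentSpace I x, IsSmoothField I X → IsSmoothField I Y →
    D X Y - D Y X - mlieBracket I X Y = 0

end SmoothFields

/-! ### The almost product connection of a metric and an almost product structure -/

section AlmostProduct

variable {E : Type*} [NormedAddCommGroup E] [NormedSpace ℝ E]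
  {H : Type*} [TopologicalSpace H] (I : ModelWithCorners ℝ E H)
  {M : Type*} [TopologicalSpace M] [ChartedSpace H M]

/-- A field `J` of endomorphisms of the tangent spaces, applied to a vector field. -/
def applyField (J : Π x : M, TangentSpace I x →L[ℝ] TangentSpace I x)
    (X : Π x : M, TangentSpace I x) : Π x : M, TangentSpace I x :=
  fun x ↦ J x (X x)

/-- The covariant derivative `(∇_X J) Y = ∇_X (J Y) - J (∇_X Y)` of a field `J` of endomorphisms,
for the Levi-Civita connection `∇` of `h`. -/
def covDerivEndo (h : Π x : M, TangentSpace I x →L[ℝ] TangentSpace I x →L[ℝ] ℝ)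
    (J : Π x : M, TangentSpace I x →L[ℝ] TangentSpace I x)
    (X Y : Π x : M, TangentSpace I x) : Π x : M, TangentSpace I x :=
  leviCivita I h X (applyField I J Y) - applyField I J (leviCivita I h X Y)

/-- The tensor field
`S(X, Y) = 1/2 { (∇_{J Y} J) X + J ((∇_Y J) X) - J ((∇_X J) Y) }`,
for the Levi-Civita connection `∇` of `h`. -/
def deformationTensor (h : Π x : M, TangentSpace I x →L[ℝ] TangentSpace I x →L[ℝ] ℝ)
    (J : Π x : M, TangentSpace I x →L[ℝ] TangentSpace I x)
    (X Y : Π x : M, TangentSpace I x) : Π x : M, TangentSpace I x :=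
  (1 / 2 : ℝ) • (covDerivEndo I h J (applyField I J Y) X
    + applyField I J (covDerivEndo I h J Y X) - applyField I J (covDerivEndo I h J X Y))

/-- The almost product connection `∇_X Y - S(X, Y)`, where `∇` is the Levi-Civita connection of
`h`. -/
def almostProductConnection (h : Π x : M, TangentSpace I x →L[ℝ] TangentSpace I x →L[ℝ] ℝ)
    (J : Π x : M, TangentSpace I x →L[ℝ] TangentSpace I x)
    (X Y : Π x : M, TangentSpace I x) : Π x : M, TangentSpace I x :=
  leviCivita I h X Y - deformationTensor I h J X Y

end AlmostProduct

/-! ### The cotangent bundle, with its lifts, metric and almost product structure -/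

section Cotangent

variable {E : Type*} [NormedAddCommGroup E] [NormedSpace ℝ E]
  {H : Type*} [TopologicalSpace H] (I : ModelWithCorners ℝ E H)
  {M : Type*} [TopologicalSpace M] [ChartedSpace H M] [IsManifold I 1 M]

/-- The cotangent space at `x`. -/
abbrev CotangentSpace (x : M) : Type _ := TangentSpace I x →L[ℝ] Bundle.Trivial M ℝ x

variable (M) in
/-- The cotangent bundle, as a manifold with model `I.prod 𝓘(ℝ, E →L[ℝ] ℝ)`. Its preferred chart at
a covector `p` over `x` is the chart `(x^i, p_i)` induced by the preferred chart `x^i` at `x`. -/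
abbrev CotangentBundle : Type _ := TotalSpace (E →L[ℝ] ℝ) (CotangentSpace I : M → Type _)

/-- The model with corners of the cotangent bundle. -/
abbrev cotangentModel : ModelWithCorners ℝ (E × (E →L[ℝ] ℝ)) (ModelProd H (E →L[ℝ] ℝ)) :=
  I.prod 𝓘(ℝ, E →L[ℝ] ℝ)

/-- The components `p_i` of a covector `p` at `x` in the preferred chart at `x`. -/
def covectorToCoord (x : M) : CotangentSpace I x →L[ℝ] (E →L[ℝ] ℝ) :=
  (ofCoordAt I x).precomp ℝ

/-- The covector at `x` with given components in the preferred chart at `x`. -/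
def covectorOfCoord (x : M) : (E →L[ℝ] ℝ) →L[ℝ] CotangentSpace I x :=
  (toCoord I x).precomp ℝ

/-- The vertical lift `ω_i ∂/∂p_i`, as a tangent vector at `p`, of a covector `ω` at the base
point of `p`. -/
def verticalLift (p : CotangentBundle I M) :
    CotangentSpace I p.proj →L[ℝ] TangentSpace (cotangentModel I) p :=
  ofCoordAt (cotangentModel I) p ∘L ContinuousLinearMap.inr ℝ E (E →L[ℝ] ℝ) ∘L
    covectorToCoord I p.proj

/-- The components `v^j ↦ p_h Γ^h_{ij} v^j`, where `Γ` are the Christoffel symbols of the metric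
`g` in the preferred chart at the base point of `p`. -/
def liftCorrection (g : Π x : M, TangentSpace I x →L[ℝ] TangentSpace I x →L[ℝ] ℝ)
    (p : CotangentBundle I M) : E →L[ℝ] (E →L[ℝ] ℝ) :=
  (covectorToCoord I p.proj p.snd).postcomp E ∘L (christoffel I g p.proj).flip

/-- The horizontal lift `v^i ∂/∂x^i + p_h Γ^h_{ij} v^j ∂/∂p_i`, as a tangent vector at `p`, of a
tangent vector `v` at the base point of `p`. -/
def horizontalLift (g : Π x : M, TangentSpace I x →L[ℝ] TangentSpace I x →L[ℝ] ℝ)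
    (p : CotangentBundle I M) :
    TangentSpace I p.proj →L[ℝ] TangentSpace (cotangentModel I) p :=
  ofCoordAt (cotangentModel I) p ∘L
    ((ContinuousLinearMap.id ℝ E).prod (liftCorrection I g p)) ∘L toCoord I p.proj

/-- The vector `v` in the decomposition `ξ = ᴴv + ⱽω` of a tangent vector `ξ` at `p`. -/
def horizontalPart (p : CotangentBundle I M) :
    TangentSpace (cotangentModel I) p →L[ℝ] TangentSpace I p.proj :=
  ofCoordAt I p.proj ∘L ContinuousLinearMap.fst ℝ E (E →L[ℝ] ℝ) ∘L toCoord (cotangentModel I) p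

/-- The covector `ω` in the decomposition `ξ = ᴴv + ⱽω` of a tangent vector `ξ` at `p`. -/
def verticalPart (g : Π x : M, TangentSpace I x →L[ℝ] TangentSpace I x →L[ℝ] ℝ)
    (p : CotangentBundle I M) :
    TangentSpace (cotangentModel I) p →L[ℝ] CotangentSpace I p.proj :=
  covectorOfCoord I p.proj ∘L
    (ContinuousLinearMap.snd ℝ E (E →L[ℝ] ℝ)
      - liftCorrection I g p ∘L ContinuousLinearMap.fst ℝ E (E →L[ℝ] ℝ)) ∘L
    toCoord (cotangentModel I) p

/-- The function `α = 1 + r²` on the cotangent bundle, where `r² = g⁻¹(p, p)`. -/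
def alpha (g : Π x : M, TangentSpace I x →L[ℝ] TangentSpace I x →L[ℝ] ℝ)
    (p : CotangentBundle I M) : ℝ :=
  1 + dualForm (g p.proj) p.snd p.snd

/-- The rescaled Riemannian metric of Cheeger-Gromoll type on the cotangent bundle: horizontal and
vertical vectors are orthogonal, the metric is `f g(v, w)` on horizontal lifts of vectors `v, w`,
and `(1/α) (g⁻¹(ω, θ) + g⁻¹(p, ω) g⁻¹(p, θ))` on vertical lifts of covectors `ω, θ`. -/
def cheegerGromollMetric (g : Π x : M, TangentSpace I x →L[ℝ] TangentSpace I x →L[ℝ] ℝ)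
    (f : M → ℝ) (p : CotangentBundle I M) :
    TangentSpace (cotangentModel I) p →L[ℝ] TangentSpace (cotangentModel I) p →L[ℝ] ℝ :=
  f p.proj • pullbackForm (g p.proj) (horizontalPart I p)
    + (1 / alpha I g p) •
      pullbackForm (dualForm (g p.proj) + tensorSquare (dualForm (g p.proj) p.snd))
        (verticalPart I g p)

/-- The almost product structure on the cotangent bundle which is `-1` on horizontal lifts and `1`
on vertical lifts. -/
def productStructure (g : Π x : M, TangentSpace I x →L[ℝ] TangentSpace I x →L[ℝ] ℝ)
    (p : CotangentBundle I M) :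
    TangentSpace (cotangentModel I) p →L[ℝ] TangentSpace (cotangentModel I) p :=
  verticalLift I p ∘L verticalPart I g p - horizontalLift I g p ∘L horizontalPart I p

end Cotangent

section LiftLemmas

variable {E : Type*} [NormedAddCommGroup E] [NormedSpace ℝ E]
  {H : Type*} [TopologicalSpace H] (I : ModelWithCorners ℝ E H)
  {M : Type*} [TopologicalSpace M] [ChartedSpace H M] [IsManifold I ∞ M]
  (g : Π x : M, TangentSpace I x →L[ℝ] TangentSpace I x →L[ℝ] ℝ)
  (f : M → ℝ) (p : CotangentBundle I M)

lemma horizontalPart_horizontalLift (v : TangentSpace I p.proj) :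
    horizontalPart I p (horizontalLift I g p v) = v := by
  simp [horizontalPart, horizontalLift, toCoord_ofCoordAt, ofCoordAt_toCoord]

lemma horizontalPart_verticalLift (η : CotangentSpace I p.proj) :
    horizontalPart I p (verticalLift I p η) = 0 := by
  simp [horizontalPart, verticalLift, toCoord_ofCoordAt]

lemma verticalPart_horizontalLift (v : TangentSpace I p.proj) :
    verticalPart I g p (horizontalLift I g p v) = 0 := by
  simp [verticalPart, horizontalLift, toCoord_ofCoordAt]

lemma verticalPart_verticalLift (η : CotangentSpace I p.proj) :
    verticalPart I g p (verticalLift I p η) = η := by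
  ext v
  simp [verticalPart, verticalLift, toCoord_ofCoordAt, covectorOfCoord, covectorToCoord,
    ofCoordAt_toCoord]

lemma cheegerGromollMetric_horizontal (v w : TangentSpace I p.proj) :
    cheegerGromollMetric I g f p (horizontalLift I g p v) (horizontalLift I g p w) =
      f p.proj * g p.proj v w := by
  simp [cheegerGromollMetric, horizontalPart_horizontalLift, verticalPart_horizontalLift]

lemma cheegerGromollMetric_mixed (η : CotangentSpace I p.proj) (w : TangentSpace I p.proj) :
    cheegerGromollMetric I g f p (verticalLift I p η) (horizontalLift I g p w) = 0 := by
  simp [cheegerGromollMetric, horizontalPart_horizontalLift, verticalPart_horizontalLift,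
    horizontalPart_verticalLift]

lemma cheegerGromollMetric_vertical (η θ : CotangentSpace I p.proj) :
    cheegerGromollMetric I g f p (verticalLift I p η) (verticalLift I p θ) =
      1 / alpha I g p * (dualForm (g p.proj) η θ
        + dualForm (g p.proj) p.snd η * dualForm (g p.proj) p.snd θ) := by
  simp [cheegerGromollMetric, horizontalPart_verticalLift, verticalPart_verticalLift, tensorSquare]

lemma productStructure_horizontalLift (v : TangentSpace I p.proj) :
    productStructure I g p (horizontalLift I g p v) = -horizontalLift I g p v := by
  simp [productStructure, horizontalPart_horizontalLift, verticalPart_horizontalLift]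

lemma productStructure_verticalLift (η : CotangentSpace I p.proj) :
    productStructure I g p (verticalLift I p η) = verticalLift I p η := by
  simp [productStructure, horizontalPart_verticalLift, verticalPart_verticalLift]

/-- Every tangent vector is uniquely `ᴴv + ⱽη`. -/
lemma lift_decomp (ξ : TangentSpace (cotangentModel I) p) :
    horizontalLift I g p (horizontalPart I p ξ) + verticalLift I p (verticalPart I g p ξ) = ξ := by
  have : ∀ a : E →L[ℝ] ℝ, covectorToCoord I p.proj (covectorOfCoord I p.proj a) = a := by
    intro a; ext v; simp [covectorToCoord, covectorOfCoord, toCoord_ofCoordAt]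
  simp only [horizontalLift, horizontalPart, verticalLift, verticalPart,
    ContinuousLinearMap.comp_apply]
  rw [this, toCoord_ofCoordAt, ← map_add]
  conv_rhs => rw [← ofCoordAt_toCoord (cotangentModel I) p ξ]
  congr 1
  ext1 <;> simp

end LiftLemmas

end CheegerGromoll

end

/-! Write `C(X, Y) = (∇_X J) Y` for the Levi-Civita connection `∇` of the metric on the cotangent
bundle. Since `∇` is torsion-free, the torsion of the almost product connection is `S(Y, X) - S(X,
Y)`. As `S` is a tensor, its symmetry can be tested at each point on horizontal and vertical
vectors, where `J` is `-1` and `1`.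

In an induced chart the horizontal vectors at `z = (x, q)` are `(a, L a)` with `L = modelLift`. The
vertical component of the bracket of two horizontal fields with constant `a`, `c` is `ρ(a, c) =
D_{(a, L a)}L c - D_{(c, L c)}L a`. Three facts, proved in `modelDeformation_symm_iff`, decide the
matter. On vertical pairs `S` is symmetric. On horizontal pairs `S(X, Y) - S(Y, X) = (0, ρ)`. On
mixed pairs `S` vanishes once `ρ = 0`: `∇_V H` is horizontal because the vertical metric is parallel
along horizontal vectors (`fderiv_modelVerticalMetric`), and the horizontal part of `∇_H V` is
controlled by `ρ` because `f g` does not depend on `q`. So the connection is symmetric exactly when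
the horizontal distribution is integrable.

Finally `ρ(a, c) e = q (R(a, c) e)` by `fderiv_modelLift_sub`. Every covector `q` occurs, so `ρ = 0`
everywhere means `R = 0`.

The rest is transfer to manifolds. The lifts at each covector are defined in its own preferred
chart, so they must be compared with a fixed chart. The inhomogeneous terms in the transformation
laws of momenta and Christoffel symbols cancel (`verticalPart_apply`, `fieldInChart_leviCivita`). -/

noncomputable section

namespace CheegerGromoll

/-! ### Christoffel symbols of a metric on an open subset of a vector space. -/

section Model

variable {E : Type*} [NormedAddCommGroup E] [NormedSpace ℝ E]

/-- The Christoffel symbols of the first kind of a metric on an open subset of a vector space. -/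
def modelChristoffelFirst (G : E → E →L[ℝ] E →L[ℝ] ℝ) (y : E) : E →L[ℝ] E →L[ℝ] E →L[ℝ] ℝ :=
  (1 / 2 : ℝ) • (fderiv ℝ G y + (fderiv ℝ G y).flip
    - (ContinuousLinearMap.flipₗᵢ ℝ E E ℝ).toContinuousLinearEquiv.toContinuousLinearMap ∘L
        (fderiv ℝ G y).flip)

/-- The Christoffel symbols of a metric on an open subset of a vector space. -/
def modelChristoffel (G : E → E →L[ℝ] E →L[ℝ] ℝ) (y : E) : E →L[ℝ] E →L[ℝ] E :=
  ((G y).inverse).postcomp E ∘L modelChristoffelFirst G y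

lemma modelChristoffelFirst_apply (G : E → E →L[ℝ] E →L[ℝ] ℝ) (y u v w : E) :
    modelChristoffelFirst G y u v w =
      (1 / 2) * (fderiv ℝ G y u v w + fderiv ℝ G y v u w - fderiv ℝ G y w u v) := rfl

lemma apply_inverse_apply {V W : Type*} [NormedAddCommGroup V] [NormedSpace ℝ V]
    [NormedAddCommGroup W] [NormedSpace ℝ W] {B : V →L[ℝ] W}
    (hB : B.IsInvertible) (w : W) : B (B.inverse w) = w := by
  obtain ⟨e, rfl⟩ := hB
  simp

lemma inverse_apply_apply {V W : Type*} [NormedAddCommGroup V] [NormedSpace ℝ V]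
    [NormedAddCommGroup W] [NormedSpace ℝ W] {B : V →L[ℝ] W}
    (hB : B.IsInvertible) (v : V) : B.inverse (B v) = v := by
  obtain ⟨e, rfl⟩ := hB
  simp

lemma apply_modelChristoffel {G : E → E →L[ℝ] E →L[ℝ] ℝ} {y : E} (hG : (G y).IsInvertible)
    (u v w : E) : G y (modelChristoffel G y u v) w = modelChristoffelFirst G y u v w :=
  DFunLike.congr_fun (apply_inverse_apply hG (modelChristoffelFirst G y u v)) w

lemma fderiv_symm_of_eventually {F : Type*} [NormedAddCommGroup F] [NormedSpace ℝ F]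
    {G : F → E →L[ℝ] E →L[ℝ] ℝ} {y : F}
    (hd : DifferentiableAt ℝ G y) (hs : ∀ᶠ z in 𝓝 y, ∀ u v, G z u v = G z v u) (a : F) (u v : E) :
    fderiv ℝ G y a u v = fderiv ℝ G y a v u := by
  have h : ∀ u v, HasFDerivAt (fun z ↦ G z u v) (((fderiv ℝ G y).flip u).flip v) y := by
    intro u v
    have := (hd.hasFDerivAt.clm_apply (hasFDerivAt_const u y)).clm_apply (hasFDerivAt_const v y)
    refine this.congr_fderiv ?_
    ext a
    simp
  have h1 := (h u v).congr_of_eventuallyEq (f₁ := fun z ↦ G z v u)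
    (hs.mono fun z hz ↦ hz v u)
  exact DFunLike.congr_fun (h1.unique (h v u)).symm a |>.symm

lemma modelChristoffel_symm {G : E → E →L[ℝ] E →L[ℝ] ℝ} {y : E}
    (hd : DifferentiableAt ℝ G y) (hs : ∀ᶠ z in 𝓝 y, ∀ u v, G z u v = G z v u) (u v : E) :
    modelChristoffel G y u v = modelChristoffel G y v u := by
  have : modelChristoffelFirst G y u v = modelChristoffelFirst G y v u := by
    ext w
    rw [modelChristoffelFirst_apply, modelChristoffelFirst_apply,
      fderiv_symm_of_eventually hd hs w u v]
    ring
  exact congrArg (G y).inverse this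

/-- This is metric compatibility, `∇G = 0`. In the sum of the two first-kind symbols the derivatives
along `u` and `v` cancel and two halves of the derivative along `a` remain. -/
lemma fderiv_apply_eq_christoffel {G : E → E →L[ℝ] E →L[ℝ] ℝ} {y : E} (hG : (G y).IsInvertible)
    (hd : DifferentiableAt ℝ G y) (hs : ∀ᶠ z in 𝓝 y, ∀ u v, G z u v = G z v u) (a u v : E) :
    fderiv ℝ G y a u v = G y (modelChristoffel G y a u) v + G y u (modelChristoffel G y a v) := by
  rw [hs.self_of_nhds u, apply_modelChristoffel hG, apply_modelChristoffel hG,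
    modelChristoffelFirst_apply, modelChristoffelFirst_apply,
    fderiv_symm_of_eventually hd hs a v u]
  ring

/-- The transformation law of the Christoffel symbols under a change of coordinates. -/
lemma modelChristoffel_transform {G G' : E → E →L[ℝ] E →L[ℝ] ℝ} {φ : E → E} {y : E}
    (hφ : ContDiffAt ℝ 2 φ y) (hφi : (fderiv ℝ φ y).IsInvertible)
    (hG : (G y).IsInvertible) (hG' : (G' (φ y)).IsInvertible) (hd : DifferentiableAt ℝ G y)
    (hd' : DifferentiableAt ℝ G' (φ y)) (hs : ∀ᶠ z in 𝓝 (φ y), ∀ u v, G' z u v = G' z v u)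
    (hGG' : ∀ᶠ z in 𝓝 y, G z = pullbackForm (G' (φ z)) (fderiv ℝ φ z)) (u v : E) :
    fderiv ℝ φ y (modelChristoffel G y u v) =
      fderiv ℝ (fderiv ℝ φ) y u v
        + modelChristoffel G' (φ y) (fderiv ℝ φ y u) (fderiv ℝ φ y v) := by
  have hφ1 : HasFDerivAt φ (fderiv ℝ φ y) y := (hφ.differentiableAt two_ne_zero).hasFDerivAt
  have hφ2 : HasFDerivAt (fderiv ℝ φ) (fderiv ℝ (fderiv ℝ φ) y) y :=
    ((hφ.fderiv_right (m := 1) (by norm_num)).differentiableAt one_ne_zero).hasFDerivAt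
  have hsymm : ∀ u v, fderiv ℝ (fderiv ℝ φ) y u v = fderiv ℝ (fderiv ℝ φ) y v u := fun u v ↦
    (hφ.isSymmSndFDerivAt (by simp)).eq u v
  have hder : ∀ a u v, fderiv ℝ G y a u v =
      fderiv ℝ G' (φ y) (fderiv ℝ φ y a) (fderiv ℝ φ y u) (fderiv ℝ φ y v)
        + G' (φ y) (fderiv ℝ (fderiv ℝ φ) y a u) (fderiv ℝ φ y v)
        + G' (φ y) (fderiv ℝ φ y u) (fderiv ℝ (fderiv ℝ φ) y a v) := by
    intro a u v
    have h1 := (hd.hasFDerivAt.clm_apply (hasFDerivAt_const u y)).clm_apply (hasFDerivAt_const v y)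
    have h2 := (((hd'.hasFDerivAt.comp y hφ1).clm_apply
      (hφ2.clm_apply (hasFDerivAt_const u y)))).clm_apply (hφ2.clm_apply (hasFDerivAt_const v y))
    have h3 := h2.congr_of_eventuallyEq (f₁ := fun z ↦ G z u v)
      (hGG'.mono fun z hz ↦ by simp [hz])
    have := DFunLike.congr_fun (h1.unique h3) a
    simp only [add_apply, ContinuousLinearMap.comp_apply,
      ContinuousLinearMap.flip_apply, zero_apply, map_zero, zero_add,
      Function.comp_apply] at this
    rw [this]
    ring
  have hinj : Function.Injective (G' (φ y)) := by
    obtain ⟨e, he⟩ := hG'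
    rw [← he]
    exact e.injective
  -- Lowering the index with `G'` leaves an identity between first-kind symbols, which involve no
  -- inverse metric. It suffices to test it on vectors `Dφ w`.
  apply hinj
  ext w'
  obtain ⟨w, rfl⟩ : ∃ w, fderiv ℝ φ y w = w' := ⟨_, apply_inverse_apply hφi w'⟩
  have e1 : G' (φ y) (fderiv ℝ φ y (modelChristoffel G y u v)) (fderiv ℝ φ y w) =
      modelChristoffelFirst G y u v w := by
    rw [← apply_modelChristoffel hG, hGG'.self_of_nhds]
    rfl
  -- The three derivatives contribute six terms with `D²φ`. By symmetry of `D²φ` and `G'`, four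
  -- cancel and the other two add up to `2 G'(D²φ(u, v), Dφ w)`.
  rw [e1, map_add, add_apply, apply_modelChristoffel hG',
    modelChristoffelFirst_apply, modelChristoffelFirst_apply, hder, hder, hder,
    hsymm v u, hsymm w u, hsymm w v, hs.self_of_nhds (fderiv ℝ φ y u)
      (fderiv ℝ (fderiv ℝ φ) y v w),
    hs.self_of_nhds (fderiv ℝ φ y v) (fderiv ℝ (fderiv ℝ φ) y u w)]
  ring

/-- A positive definite form on a finite-dimensional space is nondegenerate. -/
lemma isInvertible_of_pos [FiniteDimensional ℝ E] {B : E →L[ℝ] E →L[ℝ] ℝ}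
    (hB : ∀ v, v ≠ 0 → 0 < B v v) : B.IsInvertible := by
  have hinj : Function.Injective (B : E →ₗ[ℝ] E →L[ℝ] ℝ) := by
    rw [← LinearMap.ker_eq_bot, LinearMap.ker_eq_bot']
    intro v hv
    by_contra h
    have := hB v h
    have h' : B v = 0 := hv
    simp [h'] at this
  have hfr : Module.finrank ℝ E = Module.finrank ℝ (E →L[ℝ] ℝ) := by
    rw [← (LinearMap.toContinuousLinearMap (𝕜 := ℝ) (E := E) (F' := ℝ)).finrank_eq]
    exact (Subspace.dual_finrank_eq (K := ℝ) (V := E)).symm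
  exact ⟨(LinearEquiv.ofInjectiveOfFinrankEq _ hinj hfr).toContinuousLinearEquiv, by ext; rfl⟩

lemma contDiffAt_modelChristoffel [CompleteSpace E] {G : E → E →L[ℝ] E →L[ℝ] ℝ} {y : E}
    (hG : (G y).IsInvertible) (hd : ContDiffAt ℝ ∞ G y) :
    ContDiffAt ℝ ∞ (modelChristoffel G) y := by
  have h1 : ContDiffAt ℝ ∞ (fun z ↦ (G z).inverse) y := by
    obtain ⟨e, he⟩ := hG
    have := contDiffAt_map_inverse (n := ∞) e
    rw [he] at this
    exact this.comp y hd
  have h2 : ContDiffAt ℝ ∞ (fderiv ℝ G) y := hd.fderiv_right (by simp)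
  have h3 : ContDiffAt ℝ ∞ (modelChristoffelFirst G) y := by
    have hf : ContDiffAt ℝ ∞ (fun z ↦ (fderiv ℝ G z).flip) y :=
      (ContinuousLinearMap.flipₗᵢ ℝ E E (E →L[ℝ] ℝ)).toContinuousLinearEquiv.contDiff.contDiffAt.comp
        y h2
    exact ((h2.add hf).sub (contDiffAt_const.clm_comp hf)).const_smul (1 / 2 : ℝ)
  have h4 : ContDiffAt ℝ ∞ (fun z ↦ ContinuousLinearMap.postcomp E (G z).inverse) y :=
    ((ContinuousLinearMap.compL ℝ E (E →L[ℝ] ℝ) E).contDiff.contDiffAt).comp y h1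
  exact h4.clm_comp h3

end Model

/-! ### The deformation tensor in coordinates. -/

section ModelAlmostProduct

variable {W : Type*} [NormedAddCommGroup W] [NormedSpace ℝ W]

/-- The components of `(∇_X J) Y` for a metric `K` on an open subset of a vector space. -/
def modelCovDerivEndo (K : W → W →L[ℝ] W →L[ℝ] ℝ) (J : W → W →L[ℝ] W) (z X Y : W) : W :=
  fderiv ℝ J z X Y + modelChristoffel K z X (J z Y) - J z (modelChristoffel K z X Y)

/-- The components of the deformation tensor of `K` and `J`. -/
def modelDeformation (K : W → W →L[ℝ] W →L[ℝ] ℝ) (J : W → W →L[ℝ] W) (z X Y : W) : W :=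
  (1 / 2 : ℝ) • (modelCovDerivEndo K J z (J z Y) X + J z (modelCovDerivEndo K J z Y X)
    - J z (modelCovDerivEndo K J z X Y))

variable (K : W → W →L[ℝ] W →L[ℝ] ℝ) (J : W → W →L[ℝ] W) (z : W)

lemma modelCovDerivEndo_add_left (X X' Y : W) : modelCovDerivEndo K J z (X + X') Y =
    modelCovDerivEndo K J z X Y + modelCovDerivEndo K J z X' Y := by
  simp only [modelCovDerivEndo, map_add, add_apply]
  abel

lemma modelCovDerivEndo_add_right (X Y Y' : W) : modelCovDerivEndo K J z X (Y + Y') =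
    modelCovDerivEndo K J z X Y + modelCovDerivEndo K J z X Y' := by
  simp only [modelCovDerivEndo, map_add]
  abel

/-- Additivity and signs suffice below, because `J` acts by `±1` on the two summands of the
splitting. -/
lemma modelCovDerivEndo_neg_left (X Y : W) : modelCovDerivEndo K J z (-X) Y =
    -modelCovDerivEndo K J z X Y := by
  simp only [modelCovDerivEndo, map_neg, neg_apply]
  abel

lemma modelDeformation_add_left (X X' Y : W) : modelDeformation K J z (X + X') Y =
    modelDeformation K J z X Y + modelDeformation K J z X' Y := by
  simp only [modelDeformation, map_add, modelCovDerivEndo_add_left, modelCovDerivEndo_add_right,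
    ← smul_add]
  congr 1
  abel

lemma modelDeformation_add_right (X Y Y' : W) : modelDeformation K J z X (Y + Y') =
    modelDeformation K J z X Y + modelDeformation K J z X Y' := by
  simp only [modelDeformation, map_add, modelCovDerivEndo_add_left, modelCovDerivEndo_add_right,
    ← smul_add]
  congr 1
  abel

end ModelAlmostProduct

/-! ### Block metrics and product structures adapted to a horizontal distribution. -/

section Adapted

variable {E F : Type*} [NormedAddCommGroup E] [NormedSpace ℝ E]
  [NormedAddCommGroup F] [NormedSpace ℝ F]

/-- The vertical component `b - L a` of `(a, b)`, when the horizontal vectors are `(a, L a)`. -/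
def adaptedVertical (L : E →L[ℝ] F) : E × F →L[ℝ] F :=
  ContinuousLinearMap.snd ℝ E F - L ∘L ContinuousLinearMap.fst ℝ E F

@[simp] lemma adaptedVertical_apply (L : E →L[ℝ] F) (X : E × F) :
    adaptedVertical L X = X.2 - L X.1 := rfl

/-- The metric for which the horizontal vectors `(a, L a)` are orthogonal to the vertical vectors
`(0, b)`, with given restrictions `k₁` and `k₂` to these two spaces. -/
def adaptedMetric (k₁ : E × F → E →L[ℝ] E →L[ℝ] ℝ) (k₂ : E × F → F →L[ℝ] F →L[ℝ] ℝ)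
    (L : E × F → E →L[ℝ] F) (z : E × F) : E × F →L[ℝ] E × F →L[ℝ] ℝ :=
  pullbackForm (k₁ z) (ContinuousLinearMap.fst ℝ E F) + pullbackForm (k₂ z) (adaptedVertical (L z))

/-- The endomorphism which is `-1` on the horizontal vectors `(a, L a)` and `1` on the vertical
vectors `(0, b)`. -/
def adaptedStructure (L : E × F → E →L[ℝ] F) (z : E × F) : E × F →L[ℝ] E × F :=
  ContinuousLinearMap.inr ℝ E F ∘L adaptedVertical (L z)
    - (ContinuousLinearMap.id ℝ E).prod (L z) ∘L ContinuousLinearMap.fst ℝ E F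

variable {k₁ : E × F → E →L[ℝ] E →L[ℝ] ℝ} {k₂ : E × F → F →L[ℝ] F →L[ℝ] ℝ}
  {L : E × F → E →L[ℝ] F} {z : E × F}

lemma adaptedMetric_apply (z X Y : E × F) : adaptedMetric k₁ k₂ L z X Y =
    k₁ z X.1 Y.1 + k₂ z (X.2 - L z X.1) (Y.2 - L z Y.1) := rfl

lemma adaptedStructure_horizontal (a : E) :
    adaptedStructure L z (a, L z a) = -(a, L z a) := by
  simp [adaptedStructure]

lemma adaptedStructure_vertical (b : F) :
    adaptedStructure L z (0, b) = (0, b) := by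
  simp [adaptedStructure]

lemma adaptedStructure_apply (X : E × F) :
    adaptedStructure L z X = (-X.1, X.2 - L z X.1 - L z X.1) := by
  simp [adaptedStructure]

lemma hasFDerivAt_adaptedVertical (hL : DifferentiableAt ℝ L z) (Y : E × F) :
    HasFDerivAt (fun z ↦ Y.2 - L z Y.1) (-((fderiv ℝ L z).flip Y.1)) z := by
  have := (hasFDerivAt_const Y.2 z).sub (hL.hasFDerivAt.clm_apply (hasFDerivAt_const Y.1 z))
  refine this.congr_fderiv ?_
  ext a <;> simp

lemma differentiableAt_adaptedVertical (hL : DifferentiableAt ℝ L z) :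
    DifferentiableAt ℝ (fun z ↦ adaptedVertical (L z)) z :=
  (differentiableAt_const _).sub (hL.clm_comp (differentiableAt_const _))

lemma differentiableAt_pullbackForm {V V' W : Type*} [NormedAddCommGroup V] [NormedSpace ℝ V]
    [NormedAddCommGroup V'] [NormedSpace ℝ V'] [NormedAddCommGroup W] [NormedSpace ℝ W]
    {B : W → V →L[ℝ] V →L[ℝ] ℝ} {D : W → V' →L[ℝ] V} {z : W}
    (hB : DifferentiableAt ℝ B z) (hD : DifferentiableAt ℝ D z) :
    DifferentiableAt ℝ (fun z ↦ pullbackForm (B z) (D z)) z :=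
  ((ContinuousLinearMap.compL ℝ V' V ℝ).flip.differentiableAt.comp z hD).clm_comp
    (hB.clm_comp hD)

lemma differentiableAt_adaptedMetric (h₁ : DifferentiableAt ℝ k₁ z) (h₂ : DifferentiableAt ℝ k₂ z)
    (hL : DifferentiableAt ℝ L z) : DifferentiableAt ℝ (adaptedMetric k₁ k₂ L) z :=
  (differentiableAt_pullbackForm h₁ (differentiableAt_const _)).add
    (differentiableAt_pullbackForm h₂ (differentiableAt_adaptedVertical hL))

lemma differentiableAt_adaptedStructure (hL : DifferentiableAt ℝ L z) :
    DifferentiableAt ℝ (adaptedStructure L) z := by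
  have h : DifferentiableAt ℝ (fun z ↦ (ContinuousLinearMap.id ℝ E).prod (L z)) z :=
    DifferentiableAt.congr_of_eventuallyEq (f := fun z ↦ ContinuousLinearMap.inl ℝ E F
      + ContinuousLinearMap.inr ℝ E F ∘L L z)
      ((differentiableAt_const _).add ((differentiableAt_const _).clm_comp hL))
      (Filter.Eventually.of_forall fun z ↦ by ext <;> simp)
  exact ((differentiableAt_const _).clm_comp (differentiableAt_adaptedVertical hL)).sub
    (h.clm_comp (differentiableAt_const _))

lemma fderiv_adaptedMetric (h₁ : DifferentiableAt ℝ k₁ z) (h₂ : DifferentiableAt ℝ k₂ z)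
    (hL : DifferentiableAt ℝ L z) (X Y Z : E × F) :
    fderiv ℝ (adaptedMetric k₁ k₂ L) z X Y Z =
      fderiv ℝ k₁ z X Y.1 Z.1 + fderiv ℝ k₂ z X (Y.2 - L z Y.1) (Z.2 - L z Z.1)
        - k₂ z (fderiv ℝ L z X Y.1) (Z.2 - L z Z.1) - k₂ z (Y.2 - L z Y.1) (fderiv ℝ L z X Z.1) := by
  have e1 := ((differentiableAt_adaptedMetric h₁ h₂ hL).hasFDerivAt.clm_apply
    (hasFDerivAt_const Y z)).clm_apply (hasFDerivAt_const Z z)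
  have e2 := ((h₁.hasFDerivAt.clm_apply
    (hasFDerivAt_const Y.1 z)).clm_apply (hasFDerivAt_const Z.1 z)).add
    ((h₂.hasFDerivAt.clm_apply (hasFDerivAt_adaptedVertical hL Y)).clm_apply
      (hasFDerivAt_adaptedVertical hL Z))
  have := DFunLike.congr_fun (e1.unique e2) X
  simp only [add_apply, ContinuousLinearMap.comp_apply,
      ContinuousLinearMap.flip_apply, zero_apply, map_zero, zero_add, map_neg, neg_apply] at this
  rw [this]
  ring

/-- For fixed `Y` only the vertical slot of `J Y` varies, through `L`. Hence the derivative of `J`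
has vertical values and kills vertical vectors. -/
lemma fderiv_adaptedStructure (hL : DifferentiableAt ℝ L z) (X Y : E × F) :
    fderiv ℝ (adaptedStructure L) z X Y = (0, -fderiv ℝ L z X Y.1 - fderiv ℝ L z X Y.1) := by
  have e1 := (differentiableAt_adaptedStructure hL).hasFDerivAt.clm_apply (hasFDerivAt_const Y z)
  have hv := hasFDerivAt_adaptedVertical hL Y
  have e2 := (hasFDerivAt_const (-Y.1) z).prodMk
    (hv.sub (hL.hasFDerivAt.clm_apply (hasFDerivAt_const Y.1 z)))
  have e3 := e2.congr_of_eventuallyEq (f₁ := fun z ↦ adaptedStructure L z Y)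
    (Filter.Eventually.of_forall fun z ↦ adaptedStructure_apply Y)
  have := DFunLike.congr_fun (e1.unique e3) X
  simpa using this

lemma adaptedMetric_symm (h₁ : ∀ᶠ z in 𝓝 z, ∀ u v, k₁ z u v = k₁ z v u)
    (h₂ : ∀ᶠ z in 𝓝 z, ∀ u v, k₂ z u v = k₂ z v u) :
    ∀ᶠ z in 𝓝 z, ∀ u v, adaptedMetric k₁ k₂ L z u v = adaptedMetric k₁ k₂ L z v u := by
  filter_upwards [h₁, h₂] with z h₁ h₂ u v
  rw [adaptedMetric_apply, adaptedMetric_apply, h₁, h₂]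

lemma adaptedMetric_isInvertible [FiniteDimensional ℝ E] [FiniteDimensional ℝ F]
    (h₁ : ∀ v, v ≠ 0 → 0 < k₁ z v v) (h₂ : ∀ v, v ≠ 0 → 0 < k₂ z v v) :
    (adaptedMetric k₁ k₂ L z).IsInvertible := by
  refine isInvertible_of_pos fun X hX ↦ ?_
  rw [adaptedMetric_apply]
  have h₁' : 0 ≤ k₁ z X.1 X.1 := by
    by_cases h : X.1 = 0
    · simp [h]
    · exact (h₁ _ h).le
  by_cases h : X.2 - L z X.1 = 0
  · rw [h, map_zero, add_zero]
    refine h₁ _ fun h0 ↦ hX ?_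
    rw [h0, map_zero, sub_zero] at h
    exact Prod.ext h0 h
  · exact add_pos_of_nonneg_of_pos h₁' (h₂ _ h)

lemma eq_zero_of_forall_apply_eq_zero {V : Type*} [NormedAddCommGroup V] [NormedSpace ℝ V]
    {B : V →L[ℝ] V →L[ℝ] ℝ} (hB : ∀ v, v ≠ 0 → 0 < B v v) {v : V} (hv : ∀ w, B v w = 0) :
    v = 0 := by
  by_contra h
  exact (hB v h).ne' (hv v)

/-- If the horizontal metric is constant along the vertical vectors and the vertical metric is
parallel along the horizontal vectors, then the almost product connection is symmetric if and only
if the horizontal distribution is integrable. -/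
theorem modelDeformation_symm_iff [FiniteDimensional ℝ E] [FiniteDimensional ℝ F]
    (hd₁ : DifferentiableAt ℝ k₁ z) (hd₂ : DifferentiableAt ℝ k₂ z) (hL : DifferentiableAt ℝ L z)
    (hs₁ : ∀ᶠ z in 𝓝 z, ∀ u v, k₁ z u v = k₁ z v u)
    (hs₂ : ∀ᶠ z in 𝓝 z, ∀ u v, k₂ z u v = k₂ z v u)
    (hp₁ : ∀ v, v ≠ 0 → 0 < k₁ z v v) (hp₂ : ∀ v, v ≠ 0 → 0 < k₂ z v v)
    (hvert : ∀ b : F, fderiv ℝ k₁ z (0, b) = 0)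
    (hhor : ∀ (a : E) (b d : F), fderiv ℝ k₂ z (a, L z a) b d
      + k₂ z (fderiv ℝ L z (0, b) a) d + k₂ z b (fderiv ℝ L z (0, d) a) = 0) :
    (∀ X Y, modelDeformation (adaptedMetric k₁ k₂ L) (adaptedStructure L) z X Y =
        modelDeformation (adaptedMetric k₁ k₂ L) (adaptedStructure L) z Y X) ↔
      ∀ a c, fderiv ℝ L z (a, L z a) c = fderiv ℝ L z (c, L z c) a := by
  set K := adaptedMetric k₁ k₂ L with hK
  set J := adaptedStructure L with hJ
  have hKd : DifferentiableAt ℝ K z := differentiableAt_adaptedMetric hd₁ hd₂ hL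
  have hKi : (K z).IsInvertible := adaptedMetric_isInvertible hp₁ hp₂
  have hsymm := modelChristoffel_symm hKd (adaptedMetric_symm hs₁ hs₂)
  have hJH : ∀ a, J z (a, L z a) = -(a, L z a) := adaptedStructure_horizontal
  have hJV : ∀ b, J z (0, b) = (0, b) := adaptedStructure_vertical
  have hJd : ∀ X Y, fderiv ℝ J z X Y = (0, -fderiv ℝ L z X Y.1 - fderiv ℝ L z X Y.1) :=
    fderiv_adaptedStructure hL
  have hJa : ∀ X, J z X = (-X.1, X.2 - L z X.1 - L z X.1) := adaptedStructure_apply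
  have hKa : ∀ X Y, K z X Y = k₁ z X.1 Y.1 + k₂ z (X.2 - L z X.1) (Y.2 - L z Y.1) :=
    adaptedMetric_apply z
  have hKD := fderiv_adaptedMetric hd₁ hd₂ hL
  rw [← hK] at hKD
  clear_value K J
  -- `J` is constant on vertical vectors, so symmetry of the Christoffel symbols makes `∇J`
  -- symmetric on them. This reflects the integrability of the fibres.
  have hVV : ∀ b d : F, modelDeformation K J z (0, b) (0, d) =
      modelDeformation K J z (0, d) (0, b) := by
    intro b d
    have : modelCovDerivEndo K J z (0, b) (0, d) = modelCovDerivEndo K J z (0, d) (0, b) := by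
      simp only [modelCovDerivEndo, hJV, hJd, hsymm (0, b)]
      simp
    simp only [modelDeformation, hJV, this]
  -- The Christoffel terms cancel in `C(X, Y) - C(Y, X)`, and the derivative of `J` leaves the
  -- vertical vector `-2ρ`. In `S(X, Y) - S(Y, X)` it is counted with factors `1/2` and, from the
  -- two terms with `J`, `-1`, which gives `ρ`.
  have hHH : ∀ a c : E, modelDeformation K J z (a, L z a) (c, L z c)
      - modelDeformation K J z (c, L z c) (a, L z a) =
        (0, fderiv ℝ L z (a, L z a) c - fderiv ℝ L z (c, L z c) a) := by
    intro a c
    set ρ := fderiv ℝ L z (a, L z a) c - fderiv ℝ L z (c, L z c) a with hρ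
    have : modelCovDerivEndo K J z (a, L z a) (c, L z c) =
        modelCovDerivEndo K J z (c, L z c) (a, L z a) + (0, -(2 : ℝ) • ρ) := by
      simp only [modelCovDerivEndo, hJH, hJd, hsymm (a, L z a), map_neg]
      ext
      · simp
      · simp only [Prod.snd_sub, Prod.snd_add, hρ]
        module
    simp only [modelDeformation, hJH, modelCovDerivEndo_neg_left, this, map_add, hJV]
    ext
    · simp
    · simp only [Prod.snd_sub, Prod.snd_add, Prod.smul_snd, Prod.snd_neg]
      module
  -- Koszul's formula for the horizontal part of `∇_H V`. The assumption `hvert` removes the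
  -- derivative of `k₁` along the fibre, so only the obstruction `ρ` remains.
  have hHV : ∀ (a : E) (b c), k₁ z (modelChristoffel K z (a, L z a) (0, b)).1 c =
      -(1 / 2) * k₂ z b (fderiv ℝ L z (a, L z a) c - fderiv ℝ L z (c, L z c) a) := by
    intro a b c
    have h := apply_modelChristoffel hKi (a, L z a) (0, b) (c, L z c)
    rw [hKa, modelChristoffelFirst_apply, hKD, hKD, hKD, hvert] at h
    simp only [sub_self, map_zero, zero_apply, add_zero, zero_sub, sub_zero] at h
    rw [h, hs₂.self_of_nhds _ b, map_sub]
    ring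
  have hVH : ∀ (a : E) (b : F), modelCovDerivEndo K J z (0, b) (a, L z a) = 0 := by
    intro a b
    set γ := modelChristoffel K z (0, b) (a, L z a) with hγ
    -- The left side is the vertical part of the covariant derivative along `(0, b)` of the
    -- horizontal field `w ↦ (a, L w a)`. Paired with `d`, it is half of the expression that
    -- vanishes by `hhor`.
    have h0 : fderiv ℝ L z (0, b) a + γ.2 - L z γ.1 = 0 := by
      refine eq_zero_of_forall_apply_eq_zero hp₂ fun d ↦ ?_
      have h := apply_modelChristoffel hKi (0, b) (a, L z a) (0, d)
      rw [hKa, modelChristoffelFirst_apply, hKD, hKD, hKD, ← hγ] at h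
      simp only [sub_self, map_zero, zero_apply, add_zero, zero_sub, sub_zero, zero_add] at h
      rw [add_sub_assoc, map_add, add_apply, h]
      linarith [hhor a b d]
    have h1 : fderiv ℝ L z (0, b) a = L z γ.1 - γ.2 := by
      rw [← sub_eq_zero, ← h0]
      abel
    simp only [modelCovDerivEndo, hJH, map_neg, ← hγ, hJd, h1, hJa]
    ext
    · simp
    · simp only [Prod.snd_sub, Prod.snd_add, Prod.snd_neg, Prod.snd_zero]
      abel
  constructor
  · intro h a c
    have := hHH a c
    rw [h, sub_self] at this
    exact sub_eq_zero.1 (congrArg Prod.snd this).symm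
  · intro h
    -- With `ρ = 0` the derivative `∇_H V` is vertical, and `J` fixes it. Together with `hVH` this
    -- kills every term of `S` on mixed pairs.
    have hA : ∀ (a : E) (b : F), modelCovDerivEndo K J z (a, L z a) (0, b) = 0 := by
      intro a b
      have h0 : (modelChristoffel K z (a, L z a) (0, b)).1 = 0 := by
        refine eq_zero_of_forall_apply_eq_zero hp₁ fun c ↦ ?_
        rw [hHV, h a c, sub_self, map_zero, mul_zero]
      simp only [modelCovDerivEndo, hJV, hJd, hJa, h0]
      ext <;> simp [h0]
    have hVH' : ∀ (a : E) (b : F), modelDeformation K J z (0, b) (a, L z a) = 0 := by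
      intro a b
      simp only [modelDeformation, hJH, modelCovDerivEndo_neg_left, hA, hVH, map_zero, neg_zero,
        add_zero, sub_zero, smul_zero]
    have hHV' : ∀ (a : E) (b : F), modelDeformation K J z (a, L z a) (0, b) = 0 := by
      intro a b
      simp [modelDeformation, hJV, hA, hVH]
    have hdec : ∀ X : E × F, X = (X.1, L z X.1) + (0, X.2 - L z X.1) := by
      intro X
      ext <;> simp
    intro X Y
    rw [hdec X, hdec Y]
    simp only [modelDeformation_add_left, modelDeformation_add_right, hVH', hHV', hVV _ (Y.2 - _)]
    rw [sub_eq_zero.1 ((hHH X.1 Y.1).trans (by rw [h, sub_self]; rfl))]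

end Adapted

/-! ### The Cheeger–Gromoll metric on `E × E*`, and curvature as the obstruction. -/

section ModelCotangent

variable {E : Type*} [NormedAddCommGroup E] [NormedSpace ℝ E]

/-- `G` is a smooth Riemannian metric in a neighbourhood of `y`. -/
structure IsModelMetricAt (G : E → E →L[ℝ] E →L[ℝ] ℝ) (y : E) : Prop where
  contDiffAt : ContDiffAt ℝ ∞ G y
  symm : ∀ᶠ z in 𝓝 y, ∀ u v, G z u v = G z v u
  pos : ∀ᶠ z in 𝓝 y, ∀ v, v ≠ 0 → 0 < G z v v

/-- The components of the curvature of the Levi-Civita connection of a metric on an open subset of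
a vector space. -/
def modelCurvature (G : E → E →L[ℝ] E →L[ℝ] ℝ) (y a c e : E) : E :=
  fderiv ℝ (modelChristoffel G) y a c e - fderiv ℝ (modelChristoffel G) y c a e
    + modelChristoffel G y a (modelChristoffel G y c e)
    - modelChristoffel G y c (modelChristoffel G y a e)

/-- The components `a^j ↦ q_h Γ^h_{ij} a^j` of horizontal lifts. -/
def modelLift (G : E → E →L[ℝ] E →L[ℝ] ℝ) (z : E × (E →L[ℝ] ℝ)) : E →L[ℝ] (E →L[ℝ] ℝ) :=
  z.2.postcomp E ∘L (modelChristoffel G z.1).flip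

lemma modelLift_apply (G : E → E →L[ℝ] E →L[ℝ] ℝ) (z : E × (E →L[ℝ] ℝ)) (c e : E) :
    modelLift G z c e = z.2 (modelChristoffel G z.1 e c) := rfl

/-- The components of the Cheeger-Gromoll metric on vertical vectors. -/
def modelVerticalMetric (G : E → E →L[ℝ] E →L[ℝ] ℝ) (z : E × (E →L[ℝ] ℝ)) :
    (E →L[ℝ] ℝ) →L[ℝ] (E →L[ℝ] ℝ) →L[ℝ] ℝ :=
  (1 / (1 + dualForm (G z.1) z.2 z.2)) •
    (dualForm (G z.1) + tensorSquare (dualForm (G z.1) z.2))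

lemma modelVerticalMetric_apply (G : E → E →L[ℝ] E →L[ℝ] ℝ) (z : E × (E →L[ℝ] ℝ))
    (b d : E →L[ℝ] ℝ) : modelVerticalMetric G z b d = (1 / (1 + dualForm (G z.1) z.2 z.2)) *
      (dualForm (G z.1) b d + dualForm (G z.1) z.2 b * dualForm (G z.1) z.2 d) := by
  rfl

lemma dualForm_apply {B : E →L[ℝ] E →L[ℝ] ℝ} (hB : B.IsInvertible) (b d : E →L[ℝ] ℝ) :
    dualForm B b d = b (B.inverse d) := by
  rw [dualForm, pullbackForm_apply, apply_inverse_apply hB]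

lemma dualForm_symm {B : E →L[ℝ] E →L[ℝ] ℝ} (hs : ∀ u v, B u v = B v u) (b d : E →L[ℝ] ℝ) :
    dualForm B b d = dualForm B d b := by
  rw [dualForm, pullbackForm_apply, pullbackForm_apply, hs]

lemma dualForm_pos {B : E →L[ℝ] E →L[ℝ] ℝ} (hB : B.IsInvertible)
    (hp : ∀ v, v ≠ 0 → 0 < B v v) {b : E →L[ℝ] ℝ} (hb : b ≠ 0) : 0 < dualForm B b b := by
  rw [dualForm, pullbackForm_apply]
  refine hp _ fun h ↦ hb ?_
  rw [← apply_inverse_apply hB b, h, map_zero]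

lemma dualForm_nonneg {B : E →L[ℝ] E →L[ℝ] ℝ} (hB : B.IsInvertible)
    (hp : ∀ v, v ≠ 0 → 0 < B v v) (b : E →L[ℝ] ℝ) : 0 ≤ dualForm B b b := by
  by_cases hb : b = 0
  · simp [hb]
  · exact (dualForm_pos hB hp hb).le

lemma modelVerticalMetric_symm {G : E → E →L[ℝ] E →L[ℝ] ℝ} {z : E × (E →L[ℝ] ℝ)}
    (hs : ∀ u v, G z.1 u v = G z.1 v u) (b d : E →L[ℝ] ℝ) :
    modelVerticalMetric G z b d = modelVerticalMetric G z d b := by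
  rw [modelVerticalMetric_apply, modelVerticalMetric_apply, dualForm_symm hs b d,
    mul_comm (dualForm (G z.1) z.2 b)]

lemma modelVerticalMetric_pos {G : E → E →L[ℝ] E →L[ℝ] ℝ} {z : E × (E →L[ℝ] ℝ)}
    (hG : (G z.1).IsInvertible) (hp : ∀ v, v ≠ 0 → 0 < G z.1 v v) {b : E →L[ℝ] ℝ} (hb : b ≠ 0) :
    0 < modelVerticalMetric G z b b := by
  rw [modelVerticalMetric_apply]
  have h1 := dualForm_nonneg hG hp z.2
  have h2 := dualForm_pos hG hp hb
  have h3 := mul_self_nonneg (dualForm (G z.1) z.2 b)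
  exact mul_pos (by positivity) (by positivity)

lemma differentiableAt_inverse [CompleteSpace E] {G : E → E →L[ℝ] E →L[ℝ] ℝ} {y : E}
    (hG : (G y).IsInvertible) (hd : DifferentiableAt ℝ G y) :
    DifferentiableAt ℝ (fun z ↦ (G z).inverse) y := by
  obtain ⟨e, he⟩ := hG
  have := (contDiffAt_map_inverse (n := 1) e).differentiableAt one_ne_zero
  rw [he] at this
  exact this.comp y hd

lemma differentiableAt_dualForm [CompleteSpace E] {G : E → E →L[ℝ] E →L[ℝ] ℝ} {y : E}
    (hG : (G y).IsInvertible) (hd : DifferentiableAt ℝ G y) :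
    DifferentiableAt ℝ (fun z ↦ dualForm (G z)) y :=
  differentiableAt_pullbackForm hd (differentiableAt_inverse hG hd)

lemma IsModelMetricAt.eventually_isInvertible [FiniteDimensional ℝ E]
    {G : E → E →L[ℝ] E →L[ℝ] ℝ} {y : E} (hG : IsModelMetricAt G y) :
    ∀ᶠ z in 𝓝 y, (G z).IsInvertible :=
  hG.pos.mono fun _ ↦ isInvertible_of_pos

lemma IsModelMetricAt.differentiableAt {G : E → E →L[ℝ] E →L[ℝ] ℝ} {y : E}
    (hG : IsModelMetricAt G y) : DifferentiableAt ℝ G y :=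
  hG.contDiffAt.differentiableAt (by simp)

variable [FiniteDimensional ℝ E] {G : E → E →L[ℝ] E →L[ℝ] ℝ}

/-- The dual metric is parallel. -/
lemma fderiv_dualForm {y : E} (hG : IsModelMetricAt G y) (a : E) (b d : E →L[ℝ] ℝ) :
    fderiv ℝ (fun z ↦ dualForm (G z)) y a b d =
      -dualForm (G y) (modelLift G (y, b) a) d - dualForm (G y) b (modelLift G (y, d) a) := by
  have : CompleteSpace E := FiniteDimensional.complete ℝ E
  have hi := hG.eventually_isInvertible.self_of_nhds
  have hd := hG.differentiableAt
  have hs := hG.symm.self_of_nhds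
  have hI := (differentiableAt_inverse hi hd).hasFDerivAt
  set D := fderiv ℝ (fun z ↦ (G z).inverse) y with hD
  -- Differentiate `G (G⁻¹ d) = d`, which holds near `y`.
  have hDG : ∀ d, G y (D a d) = -fderiv ℝ G y a ((G y).inverse d) := by
    intro d
    have h1 := hd.hasFDerivAt.clm_apply (hI.clm_apply (hasFDerivAt_const d y))
    have h2 := (hasFDerivAt_const (𝕜 := ℝ) d y).congr_of_eventuallyEq
      (f₁ := fun z ↦ G z ((G z).inverse d))
      (hG.eventually_isInvertible.mono fun z hz ↦ apply_inverse_apply hz d)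
    have := DFunLike.congr_fun (h1.unique h2) a
    simp only [add_apply, ContinuousLinearMap.comp_apply,
      ContinuousLinearMap.flip_apply, zero_apply, map_zero, zero_add] at this
    exact eq_neg_of_add_eq_zero_left this
  have h1 := ((differentiableAt_dualForm hi hd).hasFDerivAt.clm_apply
    (hasFDerivAt_const b y)).clm_apply (hasFDerivAt_const d y)
  have h2 := (hasFDerivAt_const b y).clm_apply (hI.clm_apply (hasFDerivAt_const d y))
  have h3 := h2.congr_of_eventuallyEq (f₁ := fun z ↦ dualForm (G z) b d)
    (hG.eventually_isInvertible.mono fun z hz ↦ dualForm_apply hz b d)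
  have := DFunLike.congr_fun (h1.unique h3) a
  simp only [add_apply, ContinuousLinearMap.comp_apply,
      ContinuousLinearMap.flip_apply, zero_apply, map_zero, zero_add, add_zero] at this
  rw [this, dualForm_symm hs b, dualForm_apply hi, dualForm_apply hi]
  -- Covectors are written as lowered vectors, so that compatibility of `G` with its Christoffel
  -- symbols applies.
  obtain ⟨u, rfl⟩ : ∃ u, G y u = b := ⟨_, apply_inverse_apply hi b⟩
  obtain ⟨v, rfl⟩ : ∃ v, G y v = d := ⟨_, apply_inverse_apply hi d⟩
  rw [hs, hDG, neg_apply, fderiv_apply_eq_christoffel hi hd hG.symm]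
  simp only [modelLift_apply, inverse_apply_apply hi]
  rw [modelChristoffel_symm hd hG.symm v a, modelChristoffel_symm hd hG.symm u a, hs _ u]
  ring

lemma IsModelMetricAt.differentiableAt_christoffel {y : E} (hG : IsModelMetricAt G y) :
    DifferentiableAt ℝ (modelChristoffel G) y :=
  have : CompleteSpace E := FiniteDimensional.complete ℝ E
  (contDiffAt_modelChristoffel hG.eventually_isInvertible.self_of_nhds
    hG.contDiffAt).differentiableAt (by simp)

lemma differentiableAt_modelLift {z : E × (E →L[ℝ] ℝ)} (hG : IsModelMetricAt G z.1) :
    DifferentiableAt ℝ (modelLift G) z := by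
  have h1 : DifferentiableAt ℝ (fun z : E × (E →L[ℝ] ℝ) ↦ modelChristoffel G z.1) z :=
    hG.differentiableAt_christoffel.comp z differentiableAt_fst
  have h2 : DifferentiableAt ℝ (fun z : E × (E →L[ℝ] ℝ) ↦ (modelChristoffel G z.1).flip) z :=
    (ContinuousLinearMap.flipₗᵢ ℝ E E E).toContinuousLinearEquiv.differentiableAt.comp z h1
  have h3 : DifferentiableAt ℝ (fun z : E × (E →L[ℝ] ℝ) ↦ z.2.postcomp E) z :=
    (ContinuousLinearMap.compL ℝ E E ℝ).differentiableAt.comp z differentiableAt_snd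
  exact h3.clm_comp h2

lemma fderiv_modelLift {z : E × (E →L[ℝ] ℝ)} (hG : IsModelMetricAt G z.1)
    (X : E × (E →L[ℝ] ℝ)) (c e : E) :
    fderiv ℝ (modelLift G) z X c e = X.2 (modelChristoffel G z.1 e c)
      + z.2 (fderiv ℝ (modelChristoffel G) z.1 X.1 e c) := by
  have h1 := ((differentiableAt_modelLift hG).hasFDerivAt.clm_apply
    (hasFDerivAt_const c z)).clm_apply (hasFDerivAt_const e z)
  have h2 : HasFDerivAt (fun z : E × (E →L[ℝ] ℝ) ↦ modelChristoffel G z.1) _ z :=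
    hG.differentiableAt_christoffel.hasFDerivAt.comp z hasFDerivAt_fst
  have h3 : HasFDerivAt (fun z : E × (E →L[ℝ] ℝ) ↦ z.2 (modelChristoffel G z.1 e c)) _ z :=
    hasFDerivAt_snd.clm_apply
      ((h2.clm_apply (hasFDerivAt_const e z)).clm_apply (hasFDerivAt_const c z))
  have := DFunLike.congr_fun (h1.unique h3) X
  simp only [add_apply, ContinuousLinearMap.comp_apply,
      ContinuousLinearMap.flip_apply, zero_apply, map_zero, zero_add] at this
  rw [this, add_comm]
  rfl

/-- The symmetry of the Christoffel symbols holds at all points near `y`, hence may be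
differentiated. -/
lemma fderiv_modelChristoffel_symm {y : E} (hG : IsModelMetricAt G y) (a u v : E) :
    fderiv ℝ (modelChristoffel G) y a u v = fderiv ℝ (modelChristoffel G) y a v u := by
  have hd := hG.differentiableAt_christoffel.hasFDerivAt
  have h1 := (hd.clm_apply (hasFDerivAt_const u y)).clm_apply (hasFDerivAt_const v y)
  have h2 := (hd.clm_apply (hasFDerivAt_const v y)).clm_apply (hasFDerivAt_const u y)
  have h3 : ∀ᶠ z in 𝓝 y, modelChristoffel G z u v = modelChristoffel G z v u := by
    have hd' : ∀ᶠ z in 𝓝 y, DifferentiableAt ℝ G z :=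
      ((hG.contDiffAt.of_le (m := 1) (by simp)).eventually (by simp)).mono
        fun z hz ↦ hz.differentiableAt one_ne_zero
    filter_upwards [hd', hG.symm.eventually_nhds] with z hz hz'
    exact modelChristoffel_symm hz hz' u v
  have := DFunLike.congr_fun (h1.unique (h2.congr_of_eventuallyEq h3)) a
  simpa using this

/-- The curvature is the obstruction to the integrability of the horizontal distribution. -/
lemma fderiv_modelLift_sub {z : E × (E →L[ℝ] ℝ)} (hG : IsModelMetricAt G z.1) (a c e : E) :
    fderiv ℝ (modelLift G) z (a, modelLift G z a) c e
      - fderiv ℝ (modelLift G) z (c, modelLift G z c) a e = z.2 (modelCurvature G z.1 a c e) := by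
  have hs := modelChristoffel_symm hG.differentiableAt hG.symm
  -- The base direction `a` produces the derivative of `Γ`. The fibre direction `modelLift G z a`
  -- produces the quadratic terms of the curvature.
  rw [fderiv_modelLift hG, fderiv_modelLift hG, modelLift_apply, modelLift_apply, modelCurvature,
    fderiv_modelChristoffel_symm hG a e c, fderiv_modelChristoffel_symm hG c e a,
    hs (modelChristoffel G z.1 e c) a, hs (modelChristoffel G z.1 e a) c, hs c e, hs a e]
  simp only [map_add, map_sub]
  ring

lemma differentiableAt_dualForm_apply {z : E × (E →L[ℝ] ℝ)} (hG : IsModelMetricAt G z.1) :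
    DifferentiableAt ℝ (fun z : E × (E →L[ℝ] ℝ) ↦ dualForm (G z.1)) z :=
  have : CompleteSpace E := FiniteDimensional.complete ℝ E
  (differentiableAt_dualForm hG.eventually_isInvertible.self_of_nhds hG.differentiableAt).comp z
    differentiableAt_fst

lemma one_add_dualForm_pos {z : E × (E →L[ℝ] ℝ)} (hG : IsModelMetricAt G z.1) :
    0 < 1 + dualForm (G z.1) z.2 z.2 := by
  have := dualForm_nonneg hG.eventually_isInvertible.self_of_nhds hG.pos.self_of_nhds z.2
  positivity

lemma differentiableAt_smul_add_tensorSquare {V W : Type*} [NormedAddCommGroup V]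
    [NormedSpace ℝ V] [NormedAddCommGroup W] [NormedSpace ℝ W] {c : W → ℝ}
    {β : W → V →L[ℝ] V →L[ℝ] ℝ} {l : W → V →L[ℝ] ℝ} {z : W} (hc : DifferentiableAt ℝ c z)
    (hβ : DifferentiableAt ℝ β z) (hl : DifferentiableAt ℝ l z) :
    DifferentiableAt ℝ (fun z ↦ c z • (β z + tensorSquare (l z))) z := by
  have h : DifferentiableAt ℝ (fun z ↦ tensorSquare (l z)) z :=
    ((ContinuousLinearMap.smulRightL ℝ V (V →L[ℝ] ℝ)).differentiableAt.comp z hl).clm_apply hl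
  exact hc.smul (hβ.add h)

lemma differentiableAt_modelVerticalMetric {z : E × (E →L[ℝ] ℝ)} (hG : IsModelMetricAt G z.1) :
    DifferentiableAt ℝ (modelVerticalMetric G) z := by
  have h1 := differentiableAt_dualForm_apply hG
  have h2 := h1.clm_apply differentiableAt_snd
  have h3 := h2.clm_apply differentiableAt_snd
  have h4 : DifferentiableAt ℝ (fun z : E × (E →L[ℝ] ℝ) ↦ 1 / (1 + dualForm (G z.1) z.2 z.2)) z := by
    have := one_add_dualForm_pos hG
    fun_prop (disch := positivity)
  exact differentiableAt_smul_add_tensorSquare h4 h1 h2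

/-- The vertical part of the Cheeger-Gromoll metric is parallel along horizontal vectors. -/
lemma fderiv_modelVerticalMetric {z : E × (E →L[ℝ] ℝ)} (hG : IsModelMetricAt G z.1) (a : E)
    (b d : E →L[ℝ] ℝ) :
    fderiv ℝ (modelVerticalMetric G) z (a, modelLift G z a) b d
      + modelVerticalMetric G z (fderiv ℝ (modelLift G) z (0, b) a) d
      + modelVerticalMetric G z b (fderiv ℝ (modelLift G) z (0, d) a) = 0 := by
  -- The lift is linear in the momentum, so its fibre derivative is the lift with the new momentum.
  have hM : ∀ b : E →L[ℝ] ℝ, fderiv ℝ (modelLift G) z (0, b) a = modelLift G (z.1, b) a := by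
    intro b
    ext e
    simp [fderiv_modelLift hG, modelLift_apply]
  have hs := dualForm_symm hG.symm.self_of_nhds
  have hD := differentiableAt_dualForm_apply hG
  have h1 := hD.hasFDerivAt
  have hV := (differentiableAt_modelVerticalMetric hG).hasFDerivAt
  have hβ : ∀ b d : E →L[ℝ] ℝ, fderiv ℝ (fun z : E × (E →L[ℝ] ℝ) ↦ dualForm (G z.1)) z
      (a, modelLift G z a) b d = -dualForm (G z.1) (modelLift G (z.1, b) a) d
        - dualForm (G z.1) b (modelLift G (z.1, d) a) := by
    intro b d
    have : CompleteSpace E := FiniteDimensional.complete ℝ E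
    rw [← fderiv_dualForm hG a b d]
    have hd := (differentiableAt_dualForm hG.eventually_isInvertible.self_of_nhds
      hG.differentiableAt).hasFDerivAt.comp z hasFDerivAt_fst
    rw [HasFDerivAt.fderiv (f := fun z : E × (E →L[ℝ] ℝ) ↦ dualForm (G z.1)) hd]
    rfl
  set D := fderiv ℝ (fun z : E × (E →L[ℝ] ℝ) ↦ dualForm (G z.1)) z
  -- The equation multiplied by `α` is differentiated, which avoids the derivative of `1/α`.
  have hprod := ((hasFDerivAt_const (1 : ℝ) z).add
    ((h1.clm_apply hasFDerivAt_snd).clm_apply hasFDerivAt_snd)).mul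
    ((hV.clm_apply (hasFDerivAt_const b z)).clm_apply (hasFDerivAt_const d z))
  have hsum := ((h1.clm_apply (hasFDerivAt_const b z)).clm_apply (hasFDerivAt_const d z)).add
    (((h1.clm_apply hasFDerivAt_snd).clm_apply (hasFDerivAt_const b z)).mul
      ((h1.clm_apply hasFDerivAt_snd).clm_apply (hasFDerivAt_const d z)))
  have hα := one_add_dualForm_pos hG
  have hev : ∀ᶠ w in 𝓝 z, (1 + dualForm (G w.1) w.2 w.2) * modelVerticalMetric G w b d =
      dualForm (G w.1) b d + dualForm (G w.1) w.2 b * dualForm (G w.1) w.2 d := by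
    have hc : ContinuousAt (fun w : E × (E →L[ℝ] ℝ) ↦ 1 + dualForm (G w.1) w.2 w.2) z :=
      continuousAt_const.add ((hD.clm_apply differentiableAt_snd).clm_apply
        differentiableAt_snd).continuousAt
    filter_upwards [hc.eventually (lt_mem_nhds hα)] with w hw
    rw [modelVerticalMetric_apply, one_div, mul_inv_cancel_left₀ hw.ne']
  -- Along `(a, modelLift G z a)` the momentum changes by `modelLift G z a`, which compensates the
  -- change of the dual metric. Thus `α` has derivative zero, and the pairings with the momentum
  -- vary only through `b` and `d`.
  have key := DFunLike.congr_fun (hprod.unique (hsum.congr_of_eventuallyEq hev))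
    (a, modelLift G z a)
  simp only [add_apply, ContinuousLinearMap.comp_apply, smul_apply,
    ContinuousLinearMap.coe_snd', ContinuousLinearMap.flip_apply, zero_apply, map_zero, zero_add,
    hβ, smul_eq_mul, Pi.add_apply] at key
  simp only [hM]
  refine mul_left_cancel₀ hα.ne' ?_
  have e1 := modelVerticalMetric_apply G z (modelLift G (z.1, b) a) d
  have e2 := modelVerticalMetric_apply G z b (modelLift G (z.1, d) a)
  rw [one_div, eq_inv_mul_iff_mul_eq₀ hα.ne'] at e1 e2
  rw [mul_zero, mul_add, mul_add, e1, e2]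
  have e3 := hs z.2 (modelLift G z a)
  rw [Prod.mk.eta] at key
  linear_combination key

/-- The almost product connection in coordinates: its torsion at a covector `q` at `y` vanishes if
and only if the curvature at `y` composed with `q` does. -/
theorem modelDeformation_symm_iff_curvature {F : E → ℝ} {z : E × (E →L[ℝ] ℝ)}
    (hG : IsModelMetricAt G z.1) (hF : DifferentiableAt ℝ F z.1) (hpos : 0 < F z.1) :
    (∀ X Y, modelDeformation
        (adaptedMetric (fun z ↦ F z.1 • G z.1) (modelVerticalMetric G) (modelLift G))
        (adaptedStructure (modelLift G)) z X Y =
      modelDeformation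
        (adaptedMetric (fun z ↦ F z.1 • G z.1) (modelVerticalMetric G) (modelLift G))
        (adaptedStructure (modelLift G)) z Y X) ↔
      ∀ a c e, z.2 (modelCurvature G z.1 a c e) = 0 := by
  have hFG : DifferentiableAt ℝ (fun y ↦ F y • G y) z.1 := hF.smul hG.differentiableAt
  have hFG' := HasFDerivAt.comp z hFG.hasFDerivAt
    (hasFDerivAt_fst (𝕜 := ℝ) (E := E) (F := E →L[ℝ] ℝ) (p := z))
  have hev : ∀ {p : E → Prop}, (∀ᶠ y in 𝓝 z.1, p y) → ∀ᶠ w in 𝓝 z, p w.1 := fun h ↦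
    continuousAt_fst.eventually h
  rw [modelDeformation_symm_iff (k₁ := fun z : E × (E →L[ℝ] ℝ) ↦ F z.1 • G z.1)
    (k₂ := modelVerticalMetric G) (L := modelLift G) (z := z) hFG'.differentiableAt
    (differentiableAt_modelVerticalMetric hG) (differentiableAt_modelLift hG)
    ((hev hG.symm).mono fun w hw u v ↦ ?_)
    ((hev hG.symm).mono fun w hw u v ↦ modelVerticalMetric_symm hw u v)
    (fun v hv ↦ ?_)
    (fun v hv ↦ modelVerticalMetric_pos hG.eventually_isInvertible.self_of_nhds
      hG.pos.self_of_nhds hv)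
    (fun b ↦ ?_) (fun a b d ↦ fderiv_modelVerticalMetric hG a b d)]
  · refine forall_congr' fun a ↦ forall_congr' fun c ↦ ?_
    rw [← sub_eq_zero, ContinuousLinearMap.ext_iff]
    refine forall_congr' fun e ↦ ?_
    rw [sub_apply, fderiv_modelLift_sub hG, zero_apply]
  · simp [hw u v]
  · simpa using mul_pos hpos (hG.pos.self_of_nhds v hv)
  · rw [HasFDerivAt.fderiv (f := fun z : E × (E →L[ℝ] ℝ) ↦ F z.1 • G z.1) hFG']
    simp

end ModelCotangent

/-! ### Components of fields and metrics in charts, and changes of charts. -/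

section Charts

variable {E : Type*} [NormedAddCommGroup E] [NormedSpace ℝ E]
  {H : Type*} [TopologicalSpace H] (I : ModelWithCorners ℝ E H)
  {M : Type*} [TopologicalSpace M] [ChartedSpace H M]

/-- The differential at `w` of the preferred chart at `x`. -/
def coordAt (x w : M) : TangentSpace I w →L[ℝ] E :=
  mfderiv I 𝓘(ℝ, E) (extChartAt I x) w

lemma toCoord_eq_coordAt (x : M) : toCoord I x = coordAt I x x := rfl

/-- The change of coordinates from the preferred chart at `x` to the one at `x'`. -/
def coordChange (x x' : M) (y : E) : E := extChartAt I x' ((extChartAt I x).symm y)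

variable (h : Π x : M, TangentSpace I x →L[ℝ] TangentSpace I x →L[ℝ] ℝ)

lemma metricInChart_apply (x : M) (y u v : E) : metricInChart I h x y u v =
    h ((extChartAt I x).symm y) (ofCoord I x y u) (ofCoord I x y v) := rfl

lemma christoffel_eq_modelChristoffel (x : M) :
    christoffel I h x = modelChristoffel (metricInChart I h x) (extChartAt I x x) := rfl

variable [I.Boundaryless]

lemma extChartAt_target_mem_nhds_of_mem {x : M} {y : E} (hy : y ∈ (extChartAt I x).target) :
    (extChartAt I x).target ∈ 𝓝 y :=
  (isOpen_extChartAt_target x).mem_nhds hy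

lemma eventually_symm_mem_source {x x' : M} {y : E} (hy : y ∈ (extChartAt I x).target)
    (hx' : (extChartAt I x).symm y ∈ (extChartAt I x').source) :
    ∀ᶠ z in 𝓝 y, z ∈ (extChartAt I x).target ∧
      (extChartAt I x).symm z ∈ (extChartAt I x').source :=
  (Filter.eventually_mem_set.2 (extChartAt_target_mem_nhds_of_mem I hy)).and
    ((continuousAt_extChartAt_symm'' hy).eventually
      ((isOpen_extChartAt_source x').mem_nhds hx'))

variable [IsManifold I ∞ M]

lemma contDiffAt_coordChange {x x' : M} {y : E} (hy : y ∈ (extChartAt I x).target)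
    (hx' : (extChartAt I x).symm y ∈ (extChartAt I x').source) :
    ContDiffAt ℝ ∞ (coordChange I x x') y := by
  have := contDiffWithinAt_ext_coord_change (I := I) (n := ∞) x' x (y := y)
    (by simp only [PartialEquiv.trans_source, PartialEquiv.symm_source]; exact ⟨hy, hx'⟩)
  rwa [I.range_eq_univ, contDiffWithinAt_univ] at this

lemma coordAt_comp_ofCoord {x : M} {y : E} (hy : y ∈ (extChartAt I x).target) :
    coordAt I x ((extChartAt I x).symm y) ∘L ofCoord I x y = ContinuousLinearMap.id ℝ E := by
  have := mfderiv_extChartAt_comp_mfderivWithin_extChartAt_symm (I := I) hy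
  rwa [I.range_eq_univ, mfderivWithin_univ] at this

lemma ofCoord_comp_coordAt {x : M} {y : E} (hy : y ∈ (extChartAt I x).target) :
    ofCoord I x y ∘L coordAt I x ((extChartAt I x).symm y) = ContinuousLinearMap.id ℝ _ := by
  have := mfderivWithin_extChartAt_symm_comp_mfderiv_extChartAt (I := I) hy
  rwa [I.range_eq_univ, mfderivWithin_univ] at this

lemma coordAt_ofCoord {x : M} {y : E} (hy : y ∈ (extChartAt I x).target) (v : E) :
    coordAt I x ((extChartAt I x).symm y) (ofCoord I x y v) = v :=
  DFunLike.congr_fun (coordAt_comp_ofCoord I hy) v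

lemma ofCoord_coordAt {x : M} {y : E} (hy : y ∈ (extChartAt I x).target)
    (v : TangentSpace I ((extChartAt I x).symm y)) :
    ofCoord I x y (coordAt I x ((extChartAt I x).symm y) v) = v :=
  DFunLike.congr_fun (ofCoord_comp_coordAt I hy) v

lemma inverse_ofCoord {x : M} {y : E} (hy : y ∈ (extChartAt I x).target) :
    (ofCoord I x y).inverse = coordAt I x ((extChartAt I x).symm y) :=
  ContinuousLinearMap.inverse_eq (ofCoord_comp_coordAt I hy) (coordAt_comp_ofCoord I hy)

/-- The differential of the change of coordinates. -/
lemma coordAt_ofCoord_eq_fderiv {x x' : M} {y : E} (hy : y ∈ (extChartAt I x).target)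
    (hx' : (extChartAt I x).symm y ∈ (extChartAt I x').source) (v : E) :
    coordAt I x' ((extChartAt I x).symm y) (ofCoord I x y v) =
      fderiv ℝ (coordChange I x x') y v := by
  have h1 : MDifferentiableAt I 𝓘(ℝ, E) (extChartAt I x') ((extChartAt I x).symm y) :=
    mdifferentiableAt_extChartAt (by rwa [← extChartAt_source I])
  have h2 : MDifferentiableAt 𝓘(ℝ, E) I (extChartAt I x).symm y := by
    have := mdifferentiableWithinAt_extChartAt_symm (I := I) hy
    rwa [I.range_eq_univ, mdifferentiableWithinAt_univ] at this
  have := mfderiv_comp y h1 h2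
  rw [mfderiv_eq_fderiv] at this
  exact (DFunLike.congr_fun this v).symm

lemma coordAt_eq_fderiv {x x' : M} {y : E} (hy : y ∈ (extChartAt I x).target)
    (hx' : (extChartAt I x).symm y ∈ (extChartAt I x').source)
    (v : TangentSpace I ((extChartAt I x).symm y)) :
    coordAt I x' ((extChartAt I x).symm y) v =
      fderiv ℝ (coordChange I x x') y (coordAt I x ((extChartAt I x).symm y) v) := by
  rw [← coordAt_ofCoord_eq_fderiv I hy hx', ofCoord_coordAt I hy]

lemma fderiv_coordChange_isInvertible {x x' : M} {y : E} (hy : y ∈ (extChartAt I x).target)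
    (hx' : (extChartAt I x).symm y ∈ (extChartAt I x').source) :
    (fderiv ℝ (coordChange I x x') y).IsInvertible := by
  have h1 : (coordAt I x' ((extChartAt I x).symm y)).IsInvertible :=
    isInvertible_mfderiv_extChartAt hx'
  have h2 : (ofCoord I x y).IsInvertible :=
    .of_inverse (ofCoord_comp_coordAt I hy) (coordAt_comp_ofCoord I hy)
  have h3 : fderiv ℝ (coordChange I x x') y =
      coordAt I x' ((extChartAt I x).symm y) ∘L ofCoord I x y := by
    ext v
    exact (coordAt_ofCoord_eq_fderiv I hy hx' v).symm
  rw [h3]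
  exact h1.comp h2

lemma fieldInChart_eq_coordAt (Y : Π x : M, TangentSpace I x) {x : M} {y : E}
    (hy : y ∈ (extChartAt I x).target) :
    fieldInChart I Y x y =
      coordAt I x ((extChartAt I x).symm y) (Y ((extChartAt I x).symm y)) := by
  rw [fieldInChart, inverse_ofCoord I hy]

lemma fieldInChart_extChartAt (Y : Π x : M, TangentSpace I x) {x w : M}
    (hw : w ∈ (extChartAt I x).source) :
    fieldInChart I Y x (extChartAt I x w) = coordAt I x w (Y w) := by
  obtain ⟨y, hy, rfl⟩ : ∃ y ∈ (extChartAt I x).target, (extChartAt I x).symm y = w :=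
    ⟨_, (extChartAt I x).map_source hw, (extChartAt I x).left_inv hw⟩
  rw [(extChartAt I x).right_inv hy, fieldInChart_eq_coordAt I Y hy]

lemma fieldInChart_extChartAt_self (Y : Π x : M, TangentSpace I x) (x : M) :
    fieldInChart I Y x (extChartAt I x x) = toCoord I x (Y x) :=
  fieldInChart_extChartAt I Y (mem_extChartAt_source x)

lemma fieldInChart_coordChange (Y : Π x : M, TangentSpace I x) {x x' : M} {y : E}
    (hy : y ∈ (extChartAt I x).target)
    (hx' : (extChartAt I x).symm y ∈ (extChartAt I x').source) :
    fieldInChart I Y x' (coordChange I x x' y) =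
      fderiv ℝ (coordChange I x x') y (fieldInChart I Y x y) := by
  rw [coordChange, fieldInChart_extChartAt I Y hx', fieldInChart_eq_coordAt I Y hy,
    coordAt_eq_fderiv I hy hx']

lemma metricInChart_coordAt {x w : M} (hw : w ∈ (extChartAt I x).source)
    (u v : TangentSpace I w) :
    metricInChart I h x (extChartAt I x w) (coordAt I x w u) (coordAt I x w v) = h w u v := by
  obtain ⟨y, hy, rfl⟩ : ∃ y ∈ (extChartAt I x).target, (extChartAt I x).symm y = w :=
    ⟨_, (extChartAt I x).map_source hw, (extChartAt I x).left_inv hw⟩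
  rw [(extChartAt I x).right_inv hy, metricInChart_apply, ofCoord_coordAt I hy,
    ofCoord_coordAt I hy]

lemma metricInChart_coordChange {x x' : M} {y : E} (hy : y ∈ (extChartAt I x).target)
    (hx' : (extChartAt I x).symm y ∈ (extChartAt I x').source) :
    metricInChart I h x y = pullbackForm (metricInChart I h x' (coordChange I x x' y))
      (fderiv ℝ (coordChange I x x') y) := by
  ext u v
  rw [pullbackForm_apply, ← coordAt_ofCoord_eq_fderiv I hy hx',
    ← coordAt_ofCoord_eq_fderiv I hy hx', coordChange, metricInChart_coordAt I h hx']
  rfl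

-- Over the chart domain the trivialization of the tangent bundle is the differential of the chart,
-- so these components are those of a smooth section.
variable {I} in
lemma contDiffAt_fieldInChart {Y : Π x : M, TangentSpace I x} (hY : IsSmoothField I Y) {x : M}
    {y : E} (hy : y ∈ (extChartAt I x).target) : ContDiffAt ℝ ∞ (fieldInChart I Y x) y := by
  have hw : (extChartAt I x).symm y ∈ (extChartAt I x).source := (extChartAt I x).map_target hy
  have hs : (extChartAt I x).source = (chartAt H x).source := extChartAt_source I x
  have h1 := ((trivializationAt E (TangentSpace I) x).contMDiffAt_section_iff (IB := I) (n := ∞)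
    (s := Y) (x₀ := (extChartAt I x).symm y)
    (by rw [TangentBundle.trivializationAt_baseSet, ← hs]; exact hw)).1 (hY _)
  have h2 := (contMDiffOn_extChartAt_symm (I := I) (n := ∞) x).contMDiffAt
    (extChartAt_target_mem_nhds_of_mem I hy)
  refine (contMDiffAt_iff_contDiffAt.1 (h1.comp y h2)).congr_of_eventuallyEq ?_
  filter_upwards [extChartAt_target_mem_nhds_of_mem I hy] with z hz
  have hz' : (extChartAt I x).symm z ∈ (chartAt H x).source :=
    hs ▸ (extChartAt I x).map_target hz
  rw [fieldInChart_eq_coordAt I Y hz, coordAt,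
    ← TangentBundle.continuousLinearMapAt_trivializationAt hz']
  rw [Trivialization.continuousLinearMapAt_apply, Trivialization.coe_linearMapAt_of_mem _
    (by rwa [TangentBundle.trivializationAt_baseSet])]
  rfl

variable [FiniteDimensional ℝ E]

/-- The entries are the metric evaluated on coordinate fields, which are constant in the
trivialization and hence smooth. In finite dimension, smooth entries make a smooth form. -/
lemma contDiffAt_metricInChart
    (g : ContMDiffRiemannianMetric I ∞ E (TangentSpace I : M → Type _)) {x : M}
    {y : E} (hy : y ∈ (extChartAt I x).target) :
    ContDiffAt ℝ ∞ (metricInChart I g.inner x) y := by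
  have hs : (extChartAt I x).source = (chartAt H x).source := extChartAt_source I x
  set e := trivializationAt E (TangentSpace I) x
  have hsec : ∀ u : E, ContMDiffOn I I.tangent ∞
      (fun w ↦ (⟨w, e.symmL ℝ w u⟩ : TangentBundle I M)) e.baseSet := by
    intro u w hw
    refine ContMDiffAt.contMDiffWithinAt ?_
    rw [e.contMDiffAt_section_iff hw]
    refine (contMDiffAt_const (c := u)).congr_of_eventuallyEq ?_
    filter_upwards [e.open_baseSet.mem_nhds hw] with z hz
    simp [e.symmL_apply, e.apply_mk_symm hz, hz]
  have hM : ∀ u v : E, ContDiffOn ℝ ∞ (fun y ↦ metricInChart I g.inner x y u v)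
      (extChartAt I x).target := by
    intro u v y hy
    have hw : (extChartAt I x).symm y ∈ e.baseSet := by
      rw [TangentBundle.trivializationAt_baseSet, ← hs]
      exact (extChartAt I x).map_target hy
    have h1 := ContMDiffAt.clm_bundle_apply₂ (F₁ := E) (F₂ := E) (F₃ := ℝ)
      (E₃ := Bundle.Trivial M ℝ) (b := fun w ↦ w)
      (g.contMDiff ((extChartAt I x).symm y)) ((hsec u).contMDiffAt (e.open_baseSet.mem_nhds hw))
      ((hsec v).contMDiffAt (e.open_baseSet.mem_nhds hw))
    have h1' := (contMDiffAt_totalSpace.1 h1).2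
    have h2 := (contMDiffOn_extChartAt_symm (I := I) (n := ∞) x).contMDiffAt
      (extChartAt_target_mem_nhds_of_mem I hy)
    refine ((contMDiffAt_iff_contDiffAt.1 (h1'.comp y h2)).congr_of_eventuallyEq
      ?_).contDiffWithinAt
    filter_upwards [extChartAt_target_mem_nhds_of_mem I hy] with z hz
    have hz' : (extChartAt I x).symm z ∈ (chartAt H x).source :=
      hs ▸ (extChartAt I x).map_target hz
    have h3 := TangentBundle.symmL_trivializationAt (I := I) hz'
    rw [I.range_eq_univ, mfderivWithin_univ, (extChartAt I x).right_inv hz] at h3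
    simp only [Function.comp_apply, e, h3]
    rfl
  have := contDiffOn_clm_apply.2 fun u ↦ contDiffOn_clm_apply.2 (hM u)
  exact this.contDiffAt (extChartAt_target_mem_nhds_of_mem I hy)

lemma isModelMetricAt_metricInChart
    (g : ContMDiffRiemannianMetric I ∞ E (TangentSpace I : M → Type _)) {x : M}
    {y : E} (hy : y ∈ (extChartAt I x).target) :
    IsModelMetricAt (metricInChart I g.inner x) y where
  contDiffAt := contDiffAt_metricInChart I g hy
  symm := Filter.Eventually.of_forall fun z u v ↦ g.symm _ _ _
  pos := by
    filter_upwards [extChartAt_target_mem_nhds_of_mem I hy] with z hz v hv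
    refine g.pos _ _ fun h0 ↦ hv ?_
    rw [← coordAt_ofCoord I hz v]
    exact (congrArg _ h0).trans (map_zero _)

/-- The transformation law of the Christoffel symbols of a Riemannian metric. -/
lemma fderiv_coordChange_christoffel
    (g : ContMDiffRiemannianMetric I ∞ E (TangentSpace I : M → Type _)) {x x' : M}
    {y : E} (hy : y ∈ (extChartAt I x).target)
    (hx' : (extChartAt I x).symm y ∈ (extChartAt I x').source) (u v : E) :
    fderiv ℝ (coordChange I x x') y (modelChristoffel (metricInChart I g.inner x) y u v) =
      fderiv ℝ (fderiv ℝ (coordChange I x x')) y u v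
        + modelChristoffel (metricInChart I g.inner x') (coordChange I x x' y)
          (fderiv ℝ (coordChange I x x') y u) (fderiv ℝ (coordChange I x x') y v) := by
  have hG := isModelMetricAt_metricInChart I g hy
  have hG' := isModelMetricAt_metricInChart I g ((extChartAt I x').map_source hx')
  exact modelChristoffel_transform ((contDiffAt_coordChange I hy hx').of_le ENat.LEInfty.out)
    (fderiv_coordChange_isInvertible I hy hx') hG.eventually_isInvertible.self_of_nhds
    hG'.eventually_isInvertible.self_of_nhds hG.differentiableAt hG'.differentiableAt hG'.symm
    ((eventually_symm_mem_source I hy hx').mono fun z hz ↦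
      metricInChart_coordChange I g.inner hz.1 hz.2) u v

end Charts

/-! ### Torsion and curvature on a manifold, computed in charts. -/

section Connections

variable {E : Type*} [NormedAddCommGroup E] [NormedSpace ℝ E]
  {H : Type*} [TopologicalSpace H] (I : ModelWithCorners ℝ E H)
  {M : Type*} [TopologicalSpace M] [ChartedSpace H M]

section

variable [IsManifold I 1 M] (h : Π x : M, TangentSpace I x →L[ℝ] TangentSpace I x →L[ℝ] ℝ)

lemma toCoord_leviCivita (X Y : Π x : M, TangentSpace I x) (x : M) :
    toCoord I x (leviCivita I h X Y x) =
      fderiv ℝ (fieldInChart I Y x) (extChartAt I x x) (toCoord I x (X x))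
        + christoffel I h x (toCoord I x (X x)) (toCoord I x (Y x)) :=
  toCoord_ofCoordAt I x _

lemma toCoord_injective (x : M) : Function.Injective (toCoord I x) :=
  Function.LeftInverse.injective (ofCoordAt_toCoord I x)

end

variable [IsManifold I ∞ M]

/-- Every tangent vector extends to a smooth vector field. -/
lemma exists_isSmoothField [FiniteDimensional ℝ E] [T2Space M] (x : M) (v : TangentSpace I x) :
    ∃ X : Π x : M, TangentSpace I x, IsSmoothField I X ∧ X x = v := by
  obtain ⟨s, hs, hX⟩ := FiberBundle.exists_contMDiffOn_extend (k := ∞) I E v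
  -- A local extension is cut off by a bump function supported where the extension is smooth; this
  -- is where the Hausdorff property enters.
  obtain ⟨ρ, hρ⟩ := (SmoothBumpFunction.nhds_basis_tsupport (I := I) x).mem_iff.1
    (interior_mem_nhds.2 hs)
  refine ⟨fun w ↦ ρ w • FiberBundle.extend E v w, ?_, ?_⟩
  · exact ContMDiffOn.smul_section_of_tsupport ρ.contMDiff.contMDiffOn isOpen_interior hρ.2
      (hX.mono interior_subset)
  · simp

variable [I.Boundaryless]

lemma toCoord_mlieBracket (X Y : Π x : M, TangentSpace I x) (x : M) :
    toCoord I x (mlieBracket I X Y x) =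
      fderiv ℝ (fieldInChart I Y x) (extChartAt I x x) (toCoord I x (X x))
        - fderiv ℝ (fieldInChart I X x) (extChartAt I x x) (toCoord I x (Y x)) := by
  have h1 : mlieBracket I X Y x = ofCoordAt I x
      (lieBracketWithin ℝ (mpullbackWithin 𝓘(ℝ, E) I (extChartAt I x).symm X (range I))
        (mpullbackWithin 𝓘(ℝ, E) I (extChartAt I x).symm Y (range I))
        ((extChartAt I x).symm ⁻¹' univ ∩ range I) (extChartAt I x x)) := rfl
  have h2 : ∀ X : Π x : M, TangentSpace I x,
      mpullbackWithin 𝓘(ℝ, E) I (extChartAt I x).symm X (range I) = fieldInChart I X x := by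
    intro X
    ext y
    rw [I.range_eq_univ, mpullbackWithin_univ]
    rfl
  rw [h1, toCoord_ofCoordAt, h2, h2, preimage_univ, univ_inter, I.range_eq_univ,
    lieBracketWithin_univ, lieBracket, fieldInChart_extChartAt_self, fieldInChart_extChartAt_self]

section Torsion

variable (h : Π x : M, TangentSpace I x →L[ℝ] TangentSpace I x →L[ℝ] ℝ)
  (J : Π x : M, TangentSpace I x →L[ℝ] TangentSpace I x)

/-- The components of a field `J` of endomorphisms in the chart at `x`, as a function of the
coordinates. -/
def endoInChart (x : M) (y : E) : E →L[ℝ] E :=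
  coordAt I x ((extChartAt I x).symm y) ∘L J ((extChartAt I x).symm y) ∘L ofCoord I x y

variable {J}

lemma fieldInChart_applyField (Y : Π x : M, TangentSpace I x) {x : M} {y : E}
    (hy : y ∈ (extChartAt I x).target) :
    fieldInChart I (applyField I J Y) x y = endoInChart I J x y (fieldInChart I Y x y) := by
  rw [fieldInChart_eq_coordAt I _ hy, fieldInChart_eq_coordAt I _ hy, endoInChart,
    ContinuousLinearMap.comp_apply, ContinuousLinearMap.comp_apply, ofCoord_coordAt I hy]
  rfl

lemma toCoord_applyField (Y : Π x : M, TangentSpace I x) (x : M) :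
    toCoord I x (applyField I J Y x) =
      endoInChart I J x (extChartAt I x x) (toCoord I x (Y x)) := by
  rw [← fieldInChart_extChartAt_self, fieldInChart_applyField I Y (mem_extChartAt_target x),
    fieldInChart_extChartAt_self]

/-- By the Leibniz rule for `J Y` the derivatives of `Y` cancel, so only the values of the two
fields at `x` matter. -/
lemma toCoord_covDerivEndo {x : M}
    (hJ : DifferentiableAt ℝ (endoInChart I J x) (extChartAt I x x))
    (X : Π x : M, TangentSpace I x) {Y : Π x : M, TangentSpace I x}
    (hY : IsSmoothField I Y) : toCoord I x (covDerivEndo I h J X Y x) =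
      modelCovDerivEndo (metricInChart I h x) (endoInChart I J x) (extChartAt I x x)
        (toCoord I x (X x)) (toCoord I x (Y x)) := by
  have hd := (contDiffAt_fieldInChart hY (mem_extChartAt_target x)).differentiableAt (by simp)
  have h1 := (hJ.hasFDerivAt.clm_apply hd.hasFDerivAt).congr_of_eventuallyEq
    (f₁ := fieldInChart I (applyField I J Y) x)
    (Filter.mem_of_superset (extChartAt_target_mem_nhds_of_mem I (mem_extChartAt_target x))
      fun z hz ↦ fieldInChart_applyField I Y hz)
  have h2 : covDerivEndo I h J X Y x =
    leviCivita I h X (applyField I J Y) x - applyField I J (leviCivita I h X Y) x := rfl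
  rw [h2, map_sub, toCoord_leviCivita, toCoord_applyField, toCoord_applyField, toCoord_leviCivita,
    h1.fderiv, modelCovDerivEndo, fieldInChart_extChartAt_self, christoffel_eq_modelChristoffel]
  simp only [add_apply, ContinuousLinearMap.comp_apply, ContinuousLinearMap.flip_apply, map_add]
  abel

lemma toCoord_deformationTensor {x : M}
    (hJ : DifferentiableAt ℝ (endoInChart I J x) (extChartAt I x x))
    {X Y : Π x : M, TangentSpace I x} (hX : IsSmoothField I X) (hY : IsSmoothField I Y) :
    toCoord I x (deformationTensor I h J X Y x) =
      modelDeformation (metricInChart I h x) (endoInChart I J x) (extChartAt I x x)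
        (toCoord I x (X x)) (toCoord I x (Y x)) := by
  have h2 : deformationTensor I h J X Y x = (1 / 2 : ℝ) •
    (covDerivEndo I h J (applyField I J Y) X x + applyField I J (covDerivEndo I h J Y X) x
      - applyField I J (covDerivEndo I h J X Y) x) := rfl
  rw [h2, map_smul, map_sub, map_add, toCoord_applyField, toCoord_applyField,
    toCoord_covDerivEndo I h hJ _ hX, toCoord_covDerivEndo I h hJ _ hX,
    toCoord_covDerivEndo I h hJ _ hY, toCoord_applyField]
  rfl

/-- The torsion of the almost product connection. -/
lemma toCoord_torsion {x : M}
    (hJ : DifferentiableAt ℝ (endoInChart I J x) (extChartAt I x x))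
    (hh : ∀ u v, christoffel I h x u v = christoffel I h x v u)
    {X Y : Π x : M, TangentSpace I x} (hX : IsSmoothField I X) (hY : IsSmoothField I Y) :
    toCoord I x ((almostProductConnection I h J X Y - almostProductConnection I h J Y X
      - mlieBracket I X Y) x) =
      modelDeformation (metricInChart I h x) (endoInChart I J x) (extChartAt I x x)
        (toCoord I x (Y x)) (toCoord I x (X x))
      - modelDeformation (metricInChart I h x) (endoInChart I J x) (extChartAt I x x)
        (toCoord I x (X x)) (toCoord I x (Y x)) := by
  have h2 : (almostProductConnection I h J X Y - almostProductConnection I h J Y X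
      - mlieBracket I X Y) x = (leviCivita I h X Y x - deformationTensor I h J X Y x)
      - (leviCivita I h Y X x - deformationTensor I h J Y X x) - mlieBracket I X Y x := rfl
  rw [h2, map_sub, map_sub, map_sub, map_sub, toCoord_leviCivita, toCoord_leviCivita,
    toCoord_mlieBracket, toCoord_deformationTensor I h hJ hX hY,
    toCoord_deformationTensor I h hJ hY hX, hh (toCoord I x (Y x))]
  abel

end Torsion

/-- Symmetry of the almost product connection, in coordinates. -/
theorem isSymmetricConnection_iff [FiniteDimensional ℝ E] [T2Space M]
    {h : Π x : M, TangentSpace I x →L[ℝ] TangentSpace I x →L[ℝ] ℝ}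
    {J : Π x : M, TangentSpace I x →L[ℝ] TangentSpace I x}
    (hJ : ∀ x, DifferentiableAt ℝ (endoInChart I J x) (extChartAt I x x))
    (hh : ∀ x u v, christoffel I h x u v = christoffel I h x v u) :
    IsSymmetricConnection I (almostProductConnection I h J) ↔
      ∀ (x : M) (X Y : E),
        modelDeformation (metricInChart I h x) (endoInChart I J x) (extChartAt I x x) X Y =
          modelDeformation (metricInChart I h x) (endoInChart I J x) (extChartAt I x x) Y X := by
  constructor
  · intro H x a b
    -- The torsion is tensorial, so arbitrary vectors at `x` can be tested through smooth
    -- extensions.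
    obtain ⟨X, hX, hXx⟩ := exists_isSmoothField I x (ofCoordAt I x a)
    obtain ⟨Y, hY, hYx⟩ := exists_isSmoothField I x (ofCoordAt I x b)
    have h1 := toCoord_torsion I h (hJ x) (hh x) hX hY
    rw [H X Y hX hY, hXx, hYx, toCoord_ofCoordAt, toCoord_ofCoordAt] at h1
    exact (sub_eq_zero.1 (h1.symm.trans (map_zero _))).symm
  · intro H X Y hX hY
    funext x
    refine toCoord_injective I x ?_
    rw [toCoord_torsion I h (hJ x) (hh x) hX hY, H, sub_self]
    exact (map_zero _).symm

section Curvature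

variable [FiniteDimensional ℝ E]
  (g : ContMDiffRiemannianMetric I ∞ E (TangentSpace I : M → Type _))

/-- The components of `∇_X Y` in any chart are `X^i ∂_i Y^k + Γ^k_{ij} X^i Y^j`. -/
lemma fieldInChart_leviCivita (X : Π x : M, TangentSpace I x) {Y : Π x : M, TangentSpace I x}
    (hY : IsSmoothField I Y) {x : M} {y : E} (hy : y ∈ (extChartAt I x).target) :
    fieldInChart I (leviCivita I g.inner X Y) x y =
      fderiv ℝ (fieldInChart I Y x) y (fieldInChart I X x y)
        + modelChristoffel (metricInChart I g.inner x) y (fieldInChart I X x y)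
          (fieldInChart I Y x y) := by
  have hw : (extChartAt I x).symm y ∈ (extChartAt I ((extChartAt I x).symm y)).source :=
    mem_extChartAt_source _
  -- At the point `w`, `leviCivita` uses the chart at `w`, which has to be compared with the chart
  -- at `x`.
  set w := (extChartAt I x).symm y with hwdef
  have hφ := contDiffAt_coordChange I hy hw
  have hφy : coordChange I x w y = extChartAt I w w := rfl
  have hYd : DifferentiableAt ℝ (fieldInChart I Y x) y :=
    (contDiffAt_fieldInChart hY hy).differentiableAt (by simp)
  have hYd' : DifferentiableAt ℝ (fieldInChart I Y w) (coordChange I x w y) :=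
    (contDiffAt_fieldInChart hY (mem_extChartAt_target w)).differentiableAt (by simp)
  have hinj : Function.Injective (fderiv ℝ (coordChange I x w) y) := by
    obtain ⟨e, he⟩ := fderiv_coordChange_isInvertible I hy hw
    rw [← he]
    exact e.injective
  have hφd : HasFDerivAt (coordChange I x w) _ y := (hφ.differentiableAt (by simp)).hasFDerivAt
  have hφ2 : HasFDerivAt (fderiv ℝ (coordChange I x w)) _ y :=
    ((hφ.fderiv_right (m := ∞) (by simp)).differentiableAt (by simp)).hasFDerivAt
  -- With `φ` the change of charts, differentiating the law `Y ↦ Dφ Y` creates `D²φ(X, Y)`, exactly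
  -- the inhomogeneous term in the law of the Christoffel symbols.
  have h1 := (hφ2.clm_apply hYd.hasFDerivAt).congr_of_eventuallyEq
    (f₁ := fieldInChart I Y w ∘ coordChange I x w)
    ((eventually_symm_mem_source I hy hw).mono fun z hz ↦
      fieldInChart_coordChange I Y hz.1 hz.2)
  have h2 := DFunLike.congr_fun ((hYd'.hasFDerivAt.comp y hφd).unique h1) (fieldInChart I X x y)
  simp only [add_apply, ContinuousLinearMap.comp_apply, ContinuousLinearMap.flip_apply] at h2
  apply hinj
  rw [← fieldInChart_coordChange I _ hy hw, hφy, fieldInChart_extChartAt_self, toCoord_leviCivita,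
    map_add, fderiv_coordChange_christoffel I g hy hw, ← fieldInChart_coordChange I _ hy hw,
    ← fieldInChart_coordChange I _ hy hw, hφy, fieldInChart_extChartAt_self,
    fieldInChart_extChartAt_self, christoffel_eq_modelChristoffel]
  rw [← fieldInChart_coordChange I _ hy hw, hφy, fieldInChart_extChartAt_self] at h2
  rw [h2]
  abel

/-- The components of the curvature. -/
lemma toCoord_curvature {X Y Z : Π x : M, TangentSpace I x} (hX : IsSmoothField I X)
    (hY : IsSmoothField I Y) (hZ : IsSmoothField I Z) (x : M) :
    toCoord I x (curvature I g.inner X Y Z x) =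
      modelCurvature (metricInChart I g.inner x) (extChartAt I x x) (toCoord I x (X x))
        (toCoord I x (Y x)) (toCoord I x (Z x)) := by
  have hx := mem_extChartAt_target (I := I) x
  have hG := isModelMetricAt_metricInChart I g hx
  have hZ' : HasFDerivAt (fieldInChart I Z x) _ (extChartAt I x x) :=
    ((contDiffAt_fieldInChart hZ hx).differentiableAt (by simp)).hasFDerivAt
  have hZ2 : HasFDerivAt (fderiv ℝ (fieldInChart I Z x)) _ (extChartAt I x x) :=
    (((contDiffAt_fieldInChart hZ hx).fderiv_right (m := ∞) (by simp)).differentiableAt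
      (by simp)).hasFDerivAt
  have hsymm : ∀ u v, fderiv ℝ (fderiv ℝ (fieldInChart I Z x)) (extChartAt I x x) u v =
      fderiv ℝ (fderiv ℝ (fieldInChart I Z x)) (extChartAt I x x) v u := fun u v ↦
    ((contDiffAt_fieldInChart hZ hx).isSymmSndFDerivAt
      (by simpa using ENat.LEInfty.out)).eq u v
  have hΓ := hG.differentiableAt_christoffel.hasFDerivAt
  -- Iterating `∇` requires the components of `∇_Y Z` near `x` and not only at `x`, hence
  -- `fieldInChart_leviCivita`.
  have key : ∀ {Y : Π x : M, TangentSpace I x}, IsSmoothField I Y → ∀ a,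
      fderiv ℝ (fieldInChart I (leviCivita I g.inner Y Z) x) (extChartAt I x x) a =
        fderiv ℝ (fderiv ℝ (fieldInChart I Z x)) (extChartAt I x x) a (toCoord I x (Y x))
        + fderiv ℝ (fieldInChart I Z x) (extChartAt I x x)
            (fderiv ℝ (fieldInChart I Y x) (extChartAt I x x) a)
        + (fderiv ℝ (modelChristoffel (metricInChart I g.inner x)) (extChartAt I x x) a
            (toCoord I x (Y x)) (toCoord I x (Z x))
          + christoffel I g.inner x (fderiv ℝ (fieldInChart I Y x) (extChartAt I x x) a)
            (toCoord I x (Z x))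
          + christoffel I g.inner x (toCoord I x (Y x))
            (fderiv ℝ (fieldInChart I Z x) (extChartAt I x x) a)) := by
    intro Y hY a
    have hY' : HasFDerivAt (fieldInChart I Y x) _ (extChartAt I x x) :=
      ((contDiffAt_fieldInChart hY hx).differentiableAt (by simp)).hasFDerivAt
    have h1 := ((hZ2.clm_apply hY').add ((hΓ.clm_apply hY').clm_apply hZ')).congr_of_eventuallyEq
      (f₁ := fieldInChart I (leviCivita I g.inner Y Z) x)
      (Filter.mem_of_superset (extChartAt_target_mem_nhds_of_mem I hx)
        fun z hz ↦ fieldInChart_leviCivita I g Y hZ hz)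
    rw [h1.fderiv, christoffel_eq_modelChristoffel, ← fieldInChart_extChartAt_self,
      ← fieldInChart_extChartAt_self]
    simp only [add_apply, ContinuousLinearMap.comp_apply, ContinuousLinearMap.flip_apply]
    abel
  have h0 : curvature I g.inner X Y Z x = leviCivita I g.inner X (leviCivita I g.inner Y Z) x
    - leviCivita I g.inner Y (leviCivita I g.inner X Z) x
    - leviCivita I g.inner (mlieBracket I X Y) Z x := rfl
  -- Second derivatives of `Z` cancel by symmetry; the terms with derivatives of `X` and `Y` are
  -- absorbed by the bracket.
  rw [h0, map_sub, map_sub, toCoord_leviCivita, toCoord_leviCivita, toCoord_leviCivita,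
    toCoord_leviCivita, toCoord_leviCivita, toCoord_mlieBracket, key hY, key hX,
    hsymm (toCoord I x (Y x)), modelCurvature, ← christoffel_eq_modelChristoffel]
  simp only [map_add, map_sub, sub_apply]
  abel

/-- Flatness, in coordinates. -/
theorem isFlat_iff [T2Space M] : IsFlat I g.inner ↔
    ∀ (x : M) (a c e : E),
      modelCurvature (metricInChart I g.inner x) (extChartAt I x x) a c e = 0 := by
  constructor
  · intro H x a c e
    obtain ⟨X, hX, hXx⟩ := exists_isSmoothField I x (ofCoordAt I x a)
    obtain ⟨Y, hY, hYx⟩ := exists_isSmoothField I x (ofCoordAt I x c)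
    obtain ⟨Z, hZ, hZx⟩ := exists_isSmoothField I x (ofCoordAt I x e)
    have h1 := toCoord_curvature I g hX hY hZ x
    rw [H X Y Z hX hY hZ, hXx, hYx, hZx, toCoord_ofCoordAt, toCoord_ofCoordAt,
      toCoord_ofCoordAt] at h1
    exact h1.symm.trans (map_zero _)
  · intro H X Y Z hX hY hZ
    funext x
    refine toCoord_injective I x ?_
    rw [toCoord_curvature I g hX hY hZ, H]
    exact (map_zero _).symm

end Curvature

end Connections

/-- The total space of a fiber bundle with Hausdorff base and fiber is Hausdorff. -/
lemma t2Space_totalSpace {B F : Type*} {V : B → Type*} [TopologicalSpace B] [TopologicalSpace F]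
    [TopologicalSpace (TotalSpace F V)] [∀ x, TopologicalSpace (V x)] [FiberBundle F V]
    [T2Space B] [T2Space F] : T2Space (TotalSpace F V) where
  t2 := by
    intro p p' hpp'
    by_cases hp : p.proj = p'.proj
    · set e := trivializationAt F V p.proj
      have h1 : p ∈ e.source := e.mem_source.2 (FiberBundle.mem_baseSet_trivializationAt' _)
      have h2 : p' ∈ e.source :=
        e.mem_source.2 (hp ▸ FiberBundle.mem_baseSet_trivializationAt' p.proj)
      obtain ⟨u, v, hu, hv, hpu, hpv, huv⟩ := t2_separation
        (fun h ↦ hpp' (e.injOn h1 h2 h) : e p ≠ e p')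
      exact ⟨_, _, e.toOpenPartialHomeomorph.isOpen_inter_preimage hu,
        e.toOpenPartialHomeomorph.isOpen_inter_preimage hv, ⟨h1, hpu⟩, ⟨h2, hpv⟩,
        (huv.preimage e).mono inter_subset_right inter_subset_right⟩
    · obtain ⟨u, v, hu, hv, hpu, hpv, huv⟩ := t2_separation hp
      have hc := FiberBundle.continuous_proj F V
      exact ⟨_, _, hu.preimage hc, hv.preimage hc, hpu, hpv, huv.preimage _⟩

/-! ### Induced charts of the cotangent bundle and their coordinate changes. -/

section Cotangent

variable {E : Type*} [NormedAddCommGroup E] [NormedSpace ℝ E]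
  {H : Type*} [TopologicalSpace H] (I : ModelWithCorners ℝ E H)
  {M : Type*} [TopologicalSpace M] [ChartedSpace H M]

section

variable [IsManifold I ∞ M]

lemma coordAt_isInvertible {x w : M} (hw : w ∈ (extChartAt I x).source) :
    (coordAt I x w).IsInvertible :=
  isInvertible_mfderiv_extChartAt hw

lemma coordAt_inverse_apply {x w : M} (hw : w ∈ (extChartAt I x).source) (v : E) :
    coordAt I x w ((coordAt I x w).inverse v) = v := by
  obtain ⟨e, he⟩ := coordAt_isInvertible I hw
  rw [← he]
  simp

lemma inverse_coordAt_apply {x w : M} (hw : w ∈ (extChartAt I x).source) (v : TangentSpace I w) :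
    (coordAt I x w).inverse (coordAt I x w v) = v := by
  obtain ⟨e, he⟩ := coordAt_isInvertible I hw
  rw [← he]
  simp

lemma coordAt_eq_fderiv_of_mem [I.Boundaryless] {x x' w : M} (hw : w ∈ (extChartAt I x).source)
    (hw' : w ∈ (extChartAt I x').source) (v : TangentSpace I w) :
    coordAt I x' w v = fderiv ℝ (coordChange I x x') (extChartAt I x w) (coordAt I x w v) := by
  obtain ⟨y, hy, rfl⟩ : ∃ y ∈ (extChartAt I x).target, (extChartAt I x).symm y = w :=
    ⟨_, (extChartAt I x).map_source hw, (extChartAt I x).left_inv hw⟩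
  rw [(extChartAt I x).right_inv hy, coordAt_eq_fderiv I hy hw']

lemma mem_cotangent_source {p p' : CotangentBundle I M} :
    p' ∈ (extChartAt (cotangentModel I) p).source ↔ p'.proj ∈ (extChartAt I p.proj).source := by
  have h1 : (trivializationAt (E →L[ℝ] ℝ) (CotangentSpace I : M → Type _) p.proj).baseSet =
      (chartAt H p.proj).source := by
    rw [hom_trivializationAt_baseSet, TangentBundle.trivializationAt_baseSet]
    exact inter_univ _
  rw [FiberBundle.extChartAt, PartialEquiv.trans_source, mem_inter_iff, mem_preimage,
    Trivialization.mem_source, h1, ← extChartAt_source I]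
  exact ⟨fun h ↦ h.1, fun h ↦ ⟨h, h, trivial⟩⟩

/-- The trivialization of the Hom bundle precomposes with the inverse trivialization of the tangent
bundle, which is the inverse of the chart differential; on the trivial target bundle it does
nothing. -/
lemma extChartAt_cotangent {p p' : CotangentBundle I M}
    (hp' : p'.proj ∈ (extChartAt I p.proj).source) :
    extChartAt (cotangentModel I) p p' =
      (extChartAt I p.proj p'.proj, p'.snd ∘L (coordAt I p.proj p'.proj).inverse) := by
  have hs : p'.proj ∈ (chartAt H p.proj).source := by rwa [← extChartAt_source I]
  have h1 : extChartAt (cotangentModel I) p p' = (extChartAt I p.proj p'.proj,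
      ContinuousLinearMap.inCoordinates E (TangentSpace I) ℝ (Bundle.Trivial M ℝ)
        p.proj p'.proj p.proj p'.proj p'.snd) := by
    rw [FiberBundle.extChartAt]
    rfl
  rw [h1]
  congr 1
  ext v
  obtain ⟨u, rfl⟩ : ∃ u, coordAt I p.proj p'.proj u = v := ⟨_, coordAt_inverse_apply I hp' v⟩
  rw [ContinuousLinearMap.comp_apply, inverse_coordAt_apply I hp', coordAt,
    ← TangentBundle.continuousLinearMapAt_trivializationAt hs]
  simp only [ContinuousLinearMap.inCoordinates, ContinuousLinearMap.comp_apply]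
  rw [Trivialization.symmL_continuousLinearMapAt _
    (by rwa [TangentBundle.trivializationAt_baseSet])]
  simp

variable [I.Boundaryless]

section Chart

variable {I} {p p' : CotangentBundle I M}

lemma coordChange_cotangent_snd {z : E × (E →L[ℝ] ℝ)}
    (hz : z ∈ (extChartAt (cotangentModel I) p).target)
    (hp' : (extChartAt (cotangentModel I) p).symm z ∈
      (extChartAt (cotangentModel I) p').source) :
    coordChange (cotangentModel I) p p' z =
      (coordChange I p.proj p'.proj z.1,
        z.2 ∘L (fderiv ℝ (coordChange I p.proj p'.proj) z.1).inverse) := by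
  obtain ⟨w, hw, rfl⟩ : ∃ w ∈ (extChartAt (cotangentModel I) p).source,
      extChartAt (cotangentModel I) p w = z :=
    ⟨_, (extChartAt (cotangentModel I) p).map_target hz,
      (extChartAt (cotangentModel I) p).right_inv hz⟩
  rw [(extChartAt (cotangentModel I) p).left_inv hw] at hp'
  have hw1 := (mem_cotangent_source I).1 hw
  have hw2 := (mem_cotangent_source I).1 hp'
  have hy := (extChartAt I p.proj).map_source hw1
  have hl := (extChartAt I p.proj).left_inv hw1
  have hi := fderiv_coordChange_isInvertible I (x' := p'.proj) hy (by rwa [hl])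
  rw [coordChange, (extChartAt (cotangentModel I) p).left_inv hw, extChartAt_cotangent I hw1,
    extChartAt_cotangent I hw2, coordChange, hl]
  congr 1
  ext v
  obtain ⟨u, rfl⟩ : ∃ u, coordAt I p'.proj w.proj u = v := ⟨_, coordAt_inverse_apply I hw2 v⟩
  simp only [ContinuousLinearMap.comp_apply]
  rw [inverse_coordAt_apply I hw2, coordAt_eq_fderiv_of_mem I hw1 hw2, inverse_apply_apply hi,
    inverse_coordAt_apply I hw1]

end Chart

end

end Cotangent

section Cotangent

variable {E : Type*} [NormedAddCommGroup E] [NormedSpace ℝ E]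
  {H : Type*} [TopologicalSpace H] (I : ModelWithCorners ℝ E H)
  {M : Type*} [TopologicalSpace M] [ChartedSpace H M] [IsManifold I ∞ M]

section

variable [I.Boundaryless] {I} {p p' : CotangentBundle I M}

/-- The law of momenta takes the form `q' (Dφ e) = q e`, so that differentiating it involves no
derivative of an inverse. -/
lemma eventually_coordChange_cotangent {z : E × (E →L[ℝ] ℝ)}
    (hz : z ∈ (extChartAt (cotangentModel I) p).target)
    (hp' : (extChartAt (cotangentModel I) p).symm z ∈
      (extChartAt (cotangentModel I) p').source) :
    ∀ᶠ z in 𝓝 z, (coordChange (cotangentModel I) p p' z).1 = coordChange I p.proj p'.proj z.1 ∧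
      ∀ e, (coordChange (cotangentModel I) p p' z).2
        (fderiv ℝ (coordChange I p.proj p'.proj) z.1 e) = z.2 e := by
  filter_upwards [eventually_symm_mem_source (cotangentModel I) hz hp'] with z hz
  have hw := (extChartAt (cotangentModel I) p).map_target hz.1
  have hw1 := (mem_cotangent_source I).1 hw
  have hw2 := (mem_cotangent_source I).1 hz.2
  have h1 := extChartAt_cotangent I hw1
  rw [(extChartAt (cotangentModel I) p).right_inv hz.1] at h1
  have hy := (extChartAt I p.proj).map_source hw1
  rw [coordChange_cotangent_snd hz.1 hz.2]
  refine ⟨rfl, fun e ↦ ?_⟩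
  have hi := fderiv_coordChange_isInvertible I (x' := p'.proj) hy
    (by rwa [(extChartAt I p.proj).left_inv hw1])
  rw [ContinuousLinearMap.comp_apply]
  rw [show extChartAt I p.proj _ = z.1 from (congrArg Prod.fst h1).symm] at hi
  rw [inverse_apply_apply hi]

/-- The term with `D²φ` comes from the product rule applied to `q' (Dφ e) = q e`. -/
lemma fderiv_coordChange_cotangent {z : E × (E →L[ℝ] ℝ)}
    (hz : z ∈ (extChartAt (cotangentModel I) p).target)
    (hp' : (extChartAt (cotangentModel I) p).symm z ∈
      (extChartAt (cotangentModel I) p').source)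
    (hφ : ContDiffAt ℝ ∞ (coordChange I p.proj p'.proj) z.1) (X : E × (E →L[ℝ] ℝ)) (e : E) :
    (fderiv ℝ (coordChange (cotangentModel I) p p') z X).1 =
        fderiv ℝ (coordChange I p.proj p'.proj) z.1 X.1 ∧
      (fderiv ℝ (coordChange (cotangentModel I) p p') z X).2
        (fderiv ℝ (coordChange I p.proj p'.proj) z.1 e) =
        X.2 e - (coordChange (cotangentModel I) p p' z).2
          (fderiv ℝ (fderiv ℝ (coordChange I p.proj p'.proj)) z.1 X.1 e) := by
  have hΦ : HasFDerivAt (coordChange (cotangentModel I) p p') _ z :=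
    ((contDiffAt_coordChange (cotangentModel I) hz hp').differentiableAt (by simp)).hasFDerivAt
  have hφ1 : HasFDerivAt (coordChange I p.proj p'.proj) _ z.1 :=
    (hφ.differentiableAt (by simp)).hasFDerivAt
  have hφ2 : HasFDerivAt (fderiv ℝ (coordChange I p.proj p'.proj)) _ z.1 :=
    ((hφ.fderiv_right (m := ∞) (by simp)).differentiableAt (by simp)).hasFDerivAt
  have hev := eventually_coordChange_cotangent hz hp'
  constructor
  · have h1 := (hφ1.comp z hasFDerivAt_fst).congr_of_eventuallyEq (hev.mono fun z hz ↦ hz.1)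
    have h2 := hΦ.fst.unique h1
    exact DFunLike.congr_fun h2 X
  · have h1 := hΦ.snd.clm_apply ((hφ2.comp z hasFDerivAt_fst).clm_apply (hasFDerivAt_const e z))
    have h2 := (hasFDerivAt_snd.clm_apply (hasFDerivAt_const e z)).congr_of_eventuallyEq
      (hev.mono fun z hz ↦ hz.2 e)
    have h3 := DFunLike.congr_fun (h1.unique h2) X
    simp only [add_apply, ContinuousLinearMap.comp_apply, ContinuousLinearMap.flip_apply,
      zero_apply, map_zero, zero_add, ContinuousLinearMap.coe_snd',
      ContinuousLinearMap.coe_fst', Function.comp_apply] at h3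
    rw [eq_sub_iff_add_eq, add_comm]
    exact h3

end

variable [I.Boundaryless] {p p' : CotangentBundle I M}

/-- The horizontal part of a tangent vector, in the chart at `p`. -/
lemma coordAt_horizontalPart (hp' : p' ∈ (extChartAt (cotangentModel I) p).source)
    (ξ : TangentSpace (cotangentModel I) p') :
    coordAt I p.proj p'.proj (horizontalPart I p' ξ) = (coordAt (cotangentModel I) p p' ξ).1 := by
  have hw := (mem_cotangent_source I).1 hp'
  have hz := (extChartAt (cotangentModel I) p).map_source hp'
  have hl := (extChartAt (cotangentModel I) p).left_inv hp'
  have hy := (extChartAt I p.proj).map_source hw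
  have hl' := (extChartAt I p.proj).left_inv hw
  have hz1 : (extChartAt (cotangentModel I) p p').1 = extChartAt I p.proj p'.proj :=
    congrArg Prod.fst (extChartAt_cotangent I hw)
  have hs := mem_extChartAt_source (I := I) p'.proj
  have hφ : ContDiffAt ℝ ∞ (coordChange I p.proj p'.proj) (extChartAt I p.proj p'.proj) :=
    contDiffAt_coordChange I hy (by rwa [hl'])
  have hinj : Function.Injective
      (fderiv ℝ (coordChange I p.proj p'.proj) (extChartAt I p.proj p'.proj)) := by
    obtain ⟨e, he⟩ := fderiv_coordChange_isInvertible I (x' := p'.proj) hy (by rwa [hl'])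
    rw [← he]
    exact e.injective
  apply hinj
  rw [← coordAt_eq_fderiv_of_mem I hw hs, ← hz1, ← (fderiv_coordChange_cotangent hz
    (by rw [hl]; exact mem_extChartAt_source p') (by rwa [hz1]) _ 0).1,
    ← coordAt_eq_fderiv_of_mem (cotangentModel I) hp' (mem_extChartAt_source p')]
  exact toCoord_ofCoordAt I p'.proj _

variable [FiniteDimensional ℝ E]
  (g : ContMDiffRiemannianMetric I ∞ E (TangentSpace I : M → Type _))

/-- The vertical part of a tangent vector, in the chart at `p`. -/
lemma verticalPart_apply (hp' : p' ∈ (extChartAt (cotangentModel I) p).source)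
    (ξ : TangentSpace (cotangentModel I) p') (v : TangentSpace I p'.proj) :
    verticalPart I g.inner p' ξ v =
      adaptedVertical (modelLift (metricInChart I g.inner p.proj)
        (extChartAt (cotangentModel I) p p')) (coordAt (cotangentModel I) p p' ξ)
        (coordAt I p.proj p'.proj v) := by
  have hw := (mem_cotangent_source I).1 hp'
  have hz := (extChartAt (cotangentModel I) p).map_source hp'
  have hl := (extChartAt (cotangentModel I) p).left_inv hp'
  have hy := (extChartAt I p.proj).map_source hw
  have hl' := (extChartAt I p.proj).left_inv hw
  have hz1 : (extChartAt (cotangentModel I) p p').1 = extChartAt I p.proj p'.proj :=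
    congrArg Prod.fst (extChartAt_cotangent I hw)
  have hs := mem_extChartAt_source (I := I) p'.proj
  have hsN := mem_extChartAt_source (I := cotangentModel I) p'
  have hφ : ContDiffAt ℝ ∞ (coordChange I p.proj p'.proj) (extChartAt I p.proj p'.proj) :=
    contDiffAt_coordChange I hy (by rwa [hl'])
  have h1 := fderiv_coordChange_cotangent hz (by rwa [hl]) (by rwa [hz1])
    (coordAt (cotangentModel I) p p' ξ) (coordAt I p.proj p'.proj v)
  have h2 := fderiv_coordChange_christoffel I g (x' := p'.proj) hy (by rwa [hl'])
    (coordAt I p.proj p'.proj v) (coordAt (cotangentModel I) p p' ξ).1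
  have h4 := fun e ↦ ((eventually_coordChange_cotangent hz (by rwa [hl])).self_of_nhds).2 e
  set X := coordAt (cotangentModel I) p p' ξ
  set e := coordAt I p.proj p'.proj v
  have hq : (coordChange (cotangentModel I) p p' (extChartAt (cotangentModel I) p p')).2 =
      covectorToCoord I p'.proj p'.snd := by
    rw [coordChange, hl, extChartAt_cotangent I hs]
    rfl
  have h0 : verticalPart I g.inner p' ξ v =
      (toCoord (cotangentModel I) p' ξ).2 (toCoord I p'.proj v) -
      covectorToCoord I p'.proj p'.snd (christoffel I g.inner p'.proj (toCoord I p'.proj v)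
        (toCoord (cotangentModel I) p' ξ).1) := rfl
  have hsym := (hφ.isSymmSndFDerivAt (by simpa using ENat.LEInfty.out)).eq X.1 e
  have hc : christoffel I g.inner p'.proj = modelChristoffel (metricInChart I g.inner p'.proj)
      (coordChange I p.proj p'.proj (extChartAt I p.proj p'.proj)) := by
    rw [coordChange, hl', christoffel_eq_modelChristoffel]
  -- The change of momenta and the law of the Christoffel symbols each produce `q' (D²φ(X.1, e))`,
  -- up to the order of arguments. These terms agree on the two sides, so the vertical part is
  -- independent of the chart.
  rw [h0, hc, toCoord_eq_coordAt, toCoord_eq_coordAt,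
    coordAt_eq_fderiv_of_mem (cotangentModel I) hp' hsN, coordAt_eq_fderiv_of_mem I hw hs,
    ← hz1, h1.1, h1.2, hq, adaptedVertical_apply, sub_apply, modelLift_apply, ← h4, hz1, hq, h2,
    map_add, ← hsym]
  abel

end Cotangent

/-- An isometry intertwines the lowering of indices: `B u ∘ C⁻¹ = D (C u)`. -/
lemma dualForm_eq_of_isometry {V E : Type*} [NormedAddCommGroup V] [NormedSpace ℝ V]
    [NormedAddCommGroup E] [NormedSpace ℝ E] {B : V →L[ℝ] V →L[ℝ] ℝ} {D : E →L[ℝ] E →L[ℝ] ℝ}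
    {C : V →L[ℝ] E} (hB : B.IsInvertible) (hD : D.IsInvertible) (hC : C.IsInvertible)
    (h : ∀ u v, D (C u) (C v) = B u v) (η θ : V →L[ℝ] ℝ) :
    dualForm B η θ = dualForm D (η ∘L C.inverse) (θ ∘L C.inverse) := by
  obtain ⟨u, rfl⟩ : ∃ u, B u = θ := ⟨_, apply_inverse_apply hB θ⟩
  have : B u ∘L C.inverse = D (C u) := by
    ext e
    rw [ContinuousLinearMap.comp_apply, ← h, apply_inverse_apply hC]
  rw [dualForm_apply hB, dualForm_apply hD, this, inverse_apply_apply hB, inverse_apply_apply hD,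
    ContinuousLinearMap.comp_apply, inverse_apply_apply hC]

/-- The tensor depends only on the values and first derivatives of the metric and of `J` at the
point, so agreement near the centre of a chart is enough. -/
lemma modelDeformation_congr {W : Type*} [NormedAddCommGroup W] [NormedSpace ℝ W]
    {K K' : W → W →L[ℝ] W →L[ℝ] ℝ} {J J' : W → W →L[ℝ] W} {z : W} (hK : K =ᶠ[𝓝 z] K')
    (hJ : J =ᶠ[𝓝 z] J') (X Y : W) : modelDeformation K J z X Y = modelDeformation K' J' z X Y := by
  have h1 : modelChristoffel K z = modelChristoffel K' z := by
    rw [modelChristoffel, modelChristoffel, modelChristoffelFirst, modelChristoffelFirst,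
      hK.fderiv_eq, hK.self_of_nhds]
  simp only [modelDeformation, modelCovDerivEndo, h1, hJ.fderiv_eq, hJ.self_of_nhds]

/-! ### The Cheeger–Gromoll metric in induced charts, and the conclusion. -/

section Cotangent

variable {E : Type*} [NormedAddCommGroup E] [NormedSpace ℝ E]
  {H : Type*} [TopologicalSpace H] (I : ModelWithCorners ℝ E H)
  {M : Type*} [TopologicalSpace M] [ChartedSpace H M] [IsManifold I ∞ M]
  [I.Boundaryless] [FiniteDimensional ℝ E] {p p' : CotangentBundle I M}
  (g : ContMDiffRiemannianMetric I ∞ E (TangentSpace I : M → Type _)) (f : M → ℝ)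

lemma dualForm_coordAt {x w : M} (hw : w ∈ (extChartAt I x).source) (η θ : CotangentSpace I w) :
    dualForm (g.inner w) η θ = dualForm (metricInChart I g.inner x (extChartAt I x w))
      (η ∘L (coordAt I x w).inverse) (θ ∘L (coordAt I x w).inverse) := by
  have hG := isModelMetricAt_metricInChart I g ((extChartAt I x).map_source hw)
  exact dualForm_eq_of_isometry (V := E) (E := E)
    (isInvertible_of_pos (E := E) (B := g.inner w) (g.pos w))
    hG.eventually_isInvertible.self_of_nhds (coordAt_isInvertible I hw)
    (metricInChart_coordAt I g.inner hw) η θ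

/-- The Cheeger-Gromoll metric in the chart at `p`. -/
lemma cheegerGromollMetric_coordAt (hp' : p' ∈ (extChartAt (cotangentModel I) p).source)
    (ξ ζ : TangentSpace (cotangentModel I) p') :
    cheegerGromollMetric I g.inner f p' ξ ζ =
      adaptedMetric (fun z ↦ f ((extChartAt I p.proj).symm z.1) •
          metricInChart I g.inner p.proj z.1)
        (modelVerticalMetric (metricInChart I g.inner p.proj))
        (modelLift (metricInChart I g.inner p.proj)) (extChartAt (cotangentModel I) p p')
        (coordAt (cotangentModel I) p p' ξ) (coordAt (cotangentModel I) p p' ζ) := by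
  have hw := (mem_cotangent_source I).1 hp'
  have hvert : ∀ ξ, verticalPart I g.inner p' ξ ∘L (coordAt I p.proj p'.proj).inverse =
      (coordAt (cotangentModel I) p p' ξ).2 - modelLift (metricInChart I g.inner p.proj)
        (extChartAt (cotangentModel I) p p') (coordAt (cotangentModel I) p p' ξ).1 := by
    intro ξ
    ext e
    rw [ContinuousLinearMap.comp_apply, verticalPart_apply I g hp', coordAt_inverse_apply I hw,
      adaptedVertical_apply]
  have h0 : cheegerGromollMetric I g.inner f p' ξ ζ =
      f p'.proj * g.inner p'.proj (horizontalPart I p' ξ) (horizontalPart I p' ζ)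
      + 1 / (1 + dualForm (g.inner p'.proj) p'.snd p'.snd) *
        (dualForm (g.inner p'.proj) (verticalPart I g.inner p' ξ) (verticalPart I g.inner p' ζ)
          + dualForm (g.inner p'.proj) p'.snd (verticalPart I g.inner p' ξ)
            * dualForm (g.inner p'.proj) p'.snd (verticalPart I g.inner p' ζ)) := rfl
  have hz := extChartAt_cotangent I hw
  have hz1 : (extChartAt (cotangentModel I) p p').1 = extChartAt I p.proj p'.proj :=
    congrArg Prod.fst hz
  have hz2 : (extChartAt (cotangentModel I) p p').2 =
    p'.snd ∘L (coordAt I p.proj p'.proj).inverse := congrArg Prod.snd hz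
  rw [h0, dualForm_coordAt I g hw, dualForm_coordAt I g hw, dualForm_coordAt I g hw,
    dualForm_coordAt I g hw, hvert, hvert, ← metricInChart_coordAt I g.inner hw,
    coordAt_horizontalPart I hp', coordAt_horizontalPart I hp', adaptedMetric_apply,
    modelVerticalMetric_apply, hz1, hz2, (extChartAt I p.proj).left_inv hw]
  rfl

/-- The almost product structure in the chart at `p`. -/
lemma coordAt_productStructure (hp' : p' ∈ (extChartAt (cotangentModel I) p).source)
    (ξ : TangentSpace (cotangentModel I) p') :
    coordAt (cotangentModel I) p p' (productStructure I g.inner p' ξ) =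
      adaptedStructure (modelLift (metricInChart I g.inner p.proj))
        (extChartAt (cotangentModel I) p p') (coordAt (cotangentModel I) p p' ξ) := by
  have hw := (mem_cotangent_source I).1 hp'
  have h0 : productStructure I g.inner p' ξ = verticalLift I p' (verticalPart I g.inner p' ξ)
    - horizontalLift I g.inner p' (horizontalPart I p' ξ) := rfl
  -- A tangent vector is determined by its horizontal and vertical parts, whose expressions in the
  -- chart at `p` are already known.
  have h1 : horizontalPart I p' (productStructure I g.inner p' ξ) = -horizontalPart I p' ξ := by
    rw [h0, map_sub, horizontalPart_verticalLift, horizontalPart_horizontalLift, zero_sub]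
  have h2 : verticalPart I g.inner p' (productStructure I g.inner p' ξ) =
      verticalPart I g.inner p' ξ := by
    rw [h0, map_sub, verticalPart_verticalLift, verticalPart_horizontalLift, sub_zero]
  have h3 : (coordAt (cotangentModel I) p p' (productStructure I g.inner p' ξ)).1 =
      -(coordAt (cotangentModel I) p p' ξ).1 := by
    rw [← coordAt_horizontalPart I hp', h1, map_neg, coordAt_horizontalPart I hp']
  rw [adaptedStructure_apply]
  refine Prod.ext h3 ?_
  ext e
  have h4 := verticalPart_apply I g hp' (productStructure I g.inner p' ξ)
    ((coordAt I p.proj p'.proj).inverse e)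
  rw [h2, verticalPart_apply I g hp', coordAt_inverse_apply I hw, adaptedVertical_apply,
    adaptedVertical_apply, h3, map_neg, sub_neg_eq_add, sub_apply, add_apply] at h4
  rw [sub_apply, sub_apply, h4]
  ring

lemma metricInChart_cheegerGromollMetric :
    metricInChart (cotangentModel I) (cheegerGromollMetric I g.inner f) p
        =ᶠ[𝓝 (extChartAt (cotangentModel I) p p)]
      adaptedMetric (fun z ↦ f ((extChartAt I p.proj).symm z.1) •
          metricInChart I g.inner p.proj z.1)
        (modelVerticalMetric (metricInChart I g.inner p.proj))
        (modelLift (metricInChart I g.inner p.proj)) := by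
  filter_upwards [extChartAt_target_mem_nhds_of_mem (cotangentModel I)
    (mem_extChartAt_target p)] with z hz
  refine ContinuousLinearMap.ext fun X ↦ ContinuousLinearMap.ext fun Y ↦ ?_
  rw [metricInChart_apply, cheegerGromollMetric_coordAt I g f
    ((extChartAt (cotangentModel I) p).map_target hz), coordAt_ofCoord (cotangentModel I) hz,
    coordAt_ofCoord (cotangentModel I) hz, (extChartAt (cotangentModel I) p).right_inv hz]

lemma endoInChart_productStructure :
    endoInChart (cotangentModel I) (productStructure I g.inner) p
        =ᶠ[𝓝 (extChartAt (cotangentModel I) p p)]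
      adaptedStructure (modelLift (metricInChart I g.inner p.proj)) := by
  filter_upwards [extChartAt_target_mem_nhds_of_mem (cotangentModel I)
    (mem_extChartAt_target p)] with z hz
  refine ContinuousLinearMap.ext fun X ↦ ?_
  rw [endoInChart, ContinuousLinearMap.comp_apply, ContinuousLinearMap.comp_apply,
    coordAt_productStructure I g ((extChartAt (cotangentModel I) p).map_target hz),
    coordAt_ofCoord (cotangentModel I) hz, (extChartAt (cotangentModel I) p).right_inv hz]

/-- The almost product connection of the Cheeger-Gromoll metric on the cotangent bundle is
symmetric if and only if the base is flat. -/
theorem isSymmetricConnection_iff_isFlat [T2Space M] {f : M → ℝ} (hf : ContMDiff I 𝓘(ℝ, ℝ) ∞ f)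
    (hf_pos : ∀ x, 0 < f x) :
    IsSymmetricConnection (cotangentModel I) (almostProductConnection (cotangentModel I)
      (cheegerGromollMetric I g.inner f) (productStructure I g.inner)) ↔ IsFlat I g.inner := by
  -- Bump functions on the cotangent bundle, used to extend tangent vectors to smooth fields,
  -- require it to be Hausdorff.
  have hT2 : T2Space (CotangentBundle I M) := t2Space_totalSpace
  have hz : ∀ p : CotangentBundle I M, extChartAt (cotangentModel I) p p =
      (extChartAt I p.proj p.proj, p.snd ∘L (coordAt I p.proj p.proj).inverse) := fun p ↦
    extChartAt_cotangent I (mem_extChartAt_source p.proj)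
  have hG : ∀ p : CotangentBundle I M, IsModelMetricAt (metricInChart I g.inner p.proj)
      (extChartAt (cotangentModel I) p p).1 := fun p ↦ by
    rw [hz]
    exact isModelMetricAt_metricInChart I g (mem_extChartAt_target p.proj)
  have hF : ∀ x, DifferentiableAt ℝ (fun y ↦ f ((extChartAt I x).symm y)) (extChartAt I x x) := by
    intro x
    have h2 := (contMDiffOn_extChartAt_symm (I := I) (n := ∞) x).contMDiffAt
      (extChartAt_target_mem_nhds_of_mem I (mem_extChartAt_target x))
    exact (contMDiffAt_iff_contDiffAt.1 ((hf _).comp _ h2)).differentiableAt (by simp)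
  have hJ : ∀ p : CotangentBundle I M, DifferentiableAt ℝ
      (endoInChart (cotangentModel I) (productStructure I g.inner) p)
      (extChartAt (cotangentModel I) p p) := fun p ↦
    (differentiableAt_adaptedStructure (differentiableAt_modelLift (hG p))).congr_of_eventuallyEq
      (endoInChart_productStructure I g)
  have hFG : ∀ p : CotangentBundle I M, DifferentiableAt ℝ (fun z : E × (E →L[ℝ] ℝ) ↦
      f ((extChartAt I p.proj).symm z.1) • metricInChart I g.inner p.proj z.1)
      (extChartAt (cotangentModel I) p p) := by
    intro p
    have h1 : DifferentiableAt ℝ (fun y ↦ f ((extChartAt I p.proj).symm y) •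
        metricInChart I g.inner p.proj y) (extChartAt (cotangentModel I) p p).1 :=
      DifferentiableAt.smul (by rw [hz]; exact hF p.proj) (hG p).differentiableAt
    exact h1.comp (extChartAt (cotangentModel I) p p) differentiableAt_fst
  have hh : ∀ (p : CotangentBundle I M) u v,
      christoffel (cotangentModel I) (cheegerGromollMetric I g.inner f) p u v =
        christoffel (cotangentModel I) (cheegerGromollMetric I g.inner f) p v u := by
    intro p
    have hK := metricInChart_cheegerGromollMetric I g f (p := p)
    refine modelChristoffel_symm ((differentiableAt_adaptedMetric (hFG p)
      (differentiableAt_modelVerticalMetric (hG p))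
      (differentiableAt_modelLift (hG p))).congr_of_eventuallyEq hK) ?_
    have hs : ∀ y u v, metricInChart I g.inner p.proj y u v = metricInChart I g.inner p.proj y v u :=
      fun y u v ↦ g.symm _ _ _
    filter_upwards [hK, adaptedMetric_symm (L := modelLift (metricInChart I g.inner p.proj))
      (k₁ := fun z ↦ f ((extChartAt I p.proj).symm z.1) • metricInChart I g.inner p.proj z.1)
      (Filter.Eventually.of_forall fun z u v ↦
        congrArg (f ((extChartAt I p.proj).symm z.1) * ·) (hs z.1 u v))
      (Filter.Eventually.of_forall fun z u v ↦ modelVerticalMetric_symm (hs _) u v)]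
      with z hz hz' u v
    rw [hz, hz']
  rw [isSymmetricConnection_iff (cotangentModel I) hJ hh, isFlat_iff]
  have h1 : ∀ p : CotangentBundle I M,
      (∀ X Y, modelDeformation
          (metricInChart (cotangentModel I) (cheegerGromollMetric I g.inner f) p)
          (endoInChart (cotangentModel I) (productStructure I g.inner) p)
          (extChartAt (cotangentModel I) p p) X Y =
        modelDeformation
          (metricInChart (cotangentModel I) (cheegerGromollMetric I g.inner f) p)
          (endoInChart (cotangentModel I) (productStructure I g.inner) p)
          (extChartAt (cotangentModel I) p p) Y X) ↔
      ∀ a c e, p.snd ((coordAt I p.proj p.proj).inverse (modelCurvature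
        (metricInChart I g.inner p.proj) (extChartAt I p.proj p.proj) a c e)) = 0 := by
    intro p
    simp only [modelDeformation_congr (metricInChart_cheegerGromollMetric I g f)
      (endoInChart_productStructure I g)]
    rw [modelDeformation_symm_iff_curvature (F := fun y ↦ f ((extChartAt I p.proj).symm y)) (hG p)
      (by rw [hz]; exact hF p.proj) (hf_pos _), hz]
    rfl
  simp only [h1]
  constructor
  · intro h x a c e
    set v := modelCurvature (metricInChart I g.inner x) (extChartAt I x x) a c e
    -- The covector dual to the curvature vector `v` itself: its pairing with `v` is the squared
    -- length, so `v = 0`.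
    have h2 := h ⟨x, g.inner x ((coordAt I x x).inverse v)⟩ a c e
    by_contra hv
    refine (g.pos x ((coordAt I x x).inverse v) fun h0 ↦ hv ?_).ne' h2
    rw [← coordAt_inverse_apply I (mem_extChartAt_source x) v, h0]
    exact map_zero _
  · intro h p a c e
    rw [h]
    exact (congrArg _ (map_zero _)).trans (map_zero _)

end Cotangent

end CheegerGromoll

end

theorem mainTheorem5 (n : ℕ) {M : Type*} [TopologicalSpace M] [T2Space M]
    [ChartedSpace (EuclideanSpace ℝ (Fin n)) M] [IsManifold (𝓡 n) ∞ M]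
    (g : ContMDiffRiemannianMetric (𝓡 n) ∞ (EuclideanSpace ℝ (Fin n))
      (TangentSpace (𝓡 n) : M → Type _))
    (f : M → ℝ) (hf : ContMDiff (𝓡 n) 𝓘(ℝ, ℝ) ∞ f) (hf_pos : ∀ x, 0 < f x) :
    CheegerGromoll.IsSymmetricConnection (CheegerGromoll.cotangentModel (𝓡 n))
        (CheegerGromoll.almostProductConnection (CheegerGromoll.cotangentModel (𝓡 n))
          (CheegerGromoll.cheegerGromollMetric (𝓡 n) g.inner f)
          (CheegerGromoll.productStructure (𝓡 n) g.inner)) ↔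
      CheegerGromoll.IsFlat (𝓡 n) g.inner :=
  CheegerGromoll.isSymmetricConnection_iff_isFlat (𝓡 n) g hf hf_pos
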